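/- Let $G=(U,V,E)$ be a finite bipartite graph, with disjoint finite vertex sets $U,V$ and $E\subset\{\{u,v\} : u\in U, v\in V\}$. Let $C^*(G)$ be the universal unital C*-algebra generated by projections $(p_x)_{x\in U\cup V}$ subject to $\sum_{u\in U}p_u=1=\sum_{v\in V}p_v$ and $p_up_v=0$ whenever $\{u,v\}\notin E$. Let $\mathrm{Spec}(C^*(G))$ be the set of unitary equivalence classes of irreducible representations with the hull-kernel topology (the coarsest topology making $\pi\mapsto\ker\pi$ continuous, where a set $\mathcal J$ of primitive ideals has closure $\{I : I\supset\bigcap_{J\in\mathcal J}J\}$), and let $\mathrm{Spec}_{\le2}(C^*(G))$ be the subspace of classes of one- and two-dimensional representations. For $e\in E$ let $\pi_e$ be the one-dimensional representation with $\pi_e(p_x)=1$ if $x\in e$ and $\pi_e(p_x)=0$ otherwise. Let $\mathcal G$ be the set of subgraphs $H$ of $G$ isomorphic to the complete bipartite graph $K_{2,2}$. For each $H\in\mathcal G$ fix a labelling $u_1,u_2\in U$, $v_1,v_2\in V$ of its vertices, and for $0<t<1$ let $\sigma_{H,t}$ be the (irreducible) representation on $\mathbb C^2$ with $$p_{u_1}\mapsto\begin{pmatrix}1&0\\0&0\end{pmatrix},\quad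 p_{u_2}\mapsto\begin{pmatrix}0&0\\0&1\end{pmatrix},\quad p_{v_1}\mapsto\begin{pmatrix}1-t&\sqrt{t(1-t)}\\\sqrt{t(1-t)}&t\end{pmatrix},\quad p_{v_2}\mapsto\begin{pmatrix}t&-\sqrt{t(1-t)}\\-\sqrt{t(1-t)}&1-t\end{pmatrix}$$ and $p_x\mapsto0$ for all other vertices $x$. Let $X$ be the (non-Hausdorff) quotient space of the disjoint union $[0,1]\amalg[0,1]$ obtained by identifying the two copies of $t$ for every $t\in(0,1)$. Then, for every choice of the labellings: - $\mathrm{Spec}_{\le2}(C^*(G))=\{\pi_e : e\in E\}\sqcup\{\sigma_{H,t} : H\in\mathcal G,\ 0<t<1\}$. - For every $H\in\mathcal G$ the set $X_H:=\{\pi_e : e \text{ an edge of } H\}\sqcup\{\sigma_{H,t} : 0<t<1\}$ is closed in $\mathrm{Spec}_{\le2}(C^*(G))$ and homeomorphic to $X$. - There is a homeomorphism $\bigcup_{H\in\mathcal G}\{\sigma_{H,t} : 0<t<1\}\cong\coprod_{H\in\mathcal G}(0,1)$ which maps, for every $H$, the set $\{\sigma_{H,t} : 0<t<1\}$ onto the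 copy of $(0,1)$ with index $H$. - (a) If $e\in E$ is contained in no $H\in\mathcal G$, then $\{\pi_e\}$ is closed and open in $\mathrm{Spec}_{\le2}(C^*(G))$. - (b) If $e_1\ne e_2$ are edges of a common $H\in\mathcal G$, then $\pi_{e_1}$ and $\pi_{e_2}$ have disjoint open neighbourhoods in $\mathrm{Spec}_{\le2}(C^*(G))$ if and only if $e_1$ and $e_2$ are adjacent (share a vertex). - (c) For all $H\in\mathcal G$ and $0<t<1$, the point $\sigma_{H,t}$ has an open neighbourhood in $\mathrm{Spec}_{\le2}(C^*(G))$ that is homeomorphic to $(0,1)$. -/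

import Mathlib

open scoped ComplexConjugate
universe u v w z

/-- A bipartite graph with vertex classes `U` and `V` (disjoint, as they are separate types); the edge
`{u, v}` is the pair `(u, v)`. -/
structure BipartiteGraph (U : Type u) (V : Type v) where
  edges : Set (U × V)

set_option linter.unusedSectionVars false

/-- A `G`-projection family in a unital *-ring. -/
structure IsProjectionFamily {U : Type u} {V : Type v} [Fintype U] [Fintype V]
    (G : BipartiteGraph U V) {B : Type w} [Ring B] [StarRing B] (p : U ⊕ V → B) : Prop where
  isStarProjection : ∀ x, IsStarProjection (p x)
  sum_left : ∑ u : U, p (Sum.inl u) = 1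
  sum_right : ∑ v : V, p (Sum.inr v) = 1
  mul_eq_zero : ∀ u v, (u, v) ∉ G.edges → p (Sum.inl u) * p (Sum.inr v) = 0

/-- The free unital complex *-algebra on self-adjoint generators `S`: noncommutative polynomials. -/
abbrev FreeStarAlg (S : Type u) : Type u := MonoidAlgebra ℂ (FreeMonoid S)

namespace FreeStarAlg
noncomputable section
variable {S : Type u}

/-- A word in the generators. -/
def word (m : FreeMonoid S) : FreeStarAlg S := MonoidAlgebra.single m 1
/-- A generator. -/
def gen (x : S) : FreeStarAlg S := word (FreeMonoid.of x)

theorem smul_word (c : ℂ) (m : FreeMonoid S) : c • word m = MonoidAlgebra.single m c := by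
  simp [word]

theorem word_one : word (1 : FreeMonoid S) = 1 := rfl

theorem word_mul (a b : FreeMonoid S) : word (a * b) = word a * word b := by
  simp [word, MonoidAlgebra.single_mul_single]

theorem induction {P : FreeStarAlg S → Prop} (h0 : P 0) (hadd : ∀ a b, P a → P b → P (a + b))
    (hw : ∀ (c : ℂ) m, P (c • word m)) (a : FreeStarAlg S) : P a := by
  refine MonoidAlgebra.induction_linear (motive := P) a h0 hadd (fun m c => ?_)
  simpa only [smul_word] using hw c m

/-- The conjugate-linear involution that reverses words. -/
instance : Star (FreeStarAlg S) where
  star a := MonoidAlgebra.mapDomain star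
    (MonoidAlgebra.map ((starRingEnd ℂ : ℂ →+* ℂ) : ℂ →+ ℂ) a)

theorem star_def (a : FreeStarAlg S) : star a = MonoidAlgebra.mapDomain star
    (MonoidAlgebra.map ((starRingEnd ℂ : ℂ →+* ℂ) : ℂ →+ ℂ) a) := rfl

theorem star_smul_word (c : ℂ) (m : FreeMonoid S) :
    star (c • word m) = conj c • word (star m) := by
  rw [smul_word, smul_word, star_def, MonoidAlgebra.map_single, MonoidAlgebra.mapDomain_single]
  rfl

theorem star_add' (a b : FreeStarAlg S) : star (a + b) = star a + star b := by
  rw [star_def, MonoidAlgebra.map_add, MonoidAlgebra.mapDomain_add]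
  rfl

theorem star_zero' : star (0 : FreeStarAlg S) = 0 := by
  rw [star_def, MonoidAlgebra.map_zero, MonoidAlgebra.mapDomain_zero]

theorem word_smul_mul (c d : ℂ) (m n : FreeMonoid S) :
    (c • word m) * (d • word n) = (c * d) • word (m * n) := by
  rw [word_mul, smul_mul_smul_comm]

instance : StarRing (FreeStarAlg S) where
  star_involutive a := by
    refine induction (P := fun a => star (star a) = a) ?_ (fun a b ha hb => ?_)
      (fun c m => ?_) a
    · rw [star_zero', star_zero']
    · rw [star_add', star_add', ha, hb]
    · rw [star_smul_word, star_smul_word, star_star, Complex.conj_conj]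
  star_add := star_add'
  star_mul a b := by
    refine induction (P := fun a => star (a * b) = star b * star a) ?_
      (fun a a' ha ha' => ?_) (fun c m => ?_) a
    · rw [zero_mul, star_zero', mul_zero]
    · rw [add_mul, star_add', star_add', ha, ha', mul_add]
    · refine induction (P := fun b => star (c • word m * b) = star b * star (c • word m)) ?_
        (fun a a' ha ha' => ?_) (fun d n => ?_) b
      · rw [mul_zero, star_zero', zero_mul]
      · rw [mul_add, star_add', star_add', ha, ha', add_mul]
      · rw [word_smul_mul, star_smul_word, star_smul_word, star_smul_word, word_smul_mul,
          star_mul, map_mul, mul_comm]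

instance : StarModule ℂ (FreeStarAlg S) where
  star_smul c a := by
    refine induction (P := fun a => star (c • a) = star c • star a) ?_
      (fun a a' ha ha' => ?_) (fun d n => ?_) a
    · rw [smul_zero, star_zero', smul_zero]
    · rw [smul_add, star_add', star_add', ha, ha', smul_add]
    · rw [smul_smul, star_smul_word, star_smul_word, smul_smul, map_mul]
      rfl

theorem star_gen (x : S) : star (gen x) = gen x := by
  have := star_smul_word 1 (FreeMonoid.of x)
  rwa [map_one, one_smul, one_smul, FreeMonoid.star_of] at this

/-- The evaluation of noncommutative polynomials at self-adjoint elements. -/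
def eval {B : Type w} [Ring B] [StarRing B] [Algebra ℂ B] [StarModule ℂ B] (y : S → B)
    (hy : ∀ x, IsSelfAdjoint (y x)) : FreeStarAlg S →⋆ₐ[ℂ] B where
  __ := MonoidAlgebra.lift ℂ B (FreeMonoid S) (FreeMonoid.lift y)
  map_star' a := by
    let φ := MonoidAlgebra.lift ℂ B (FreeMonoid S) (FreeMonoid.lift y)
    have hφ : ∀ m, φ (word m) = FreeMonoid.lift y m := fun m => by
      simp [φ, word, MonoidAlgebra.lift_single]
    change φ (star a) = star (φ a)
    refine induction (P := fun a => φ (star a) = star (φ a)) ?_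
      (fun a a' ha ha' => ?_) (fun c m => ?_) a
    · rw [star_zero', map_zero, star_zero]
    · rw [star_add', map_add, map_add, star_add, ha, ha']
    · rw [star_smul_word, map_smul, map_smul, hφ, hφ, star_smul]
      congr 1
      induction m using FreeMonoid.inductionOn' with
      | one => simp
      | of_mul x m ih => rw [star_mul, map_mul, map_mul, star_mul, ih, FreeMonoid.star_of,
            FreeMonoid.lift_eval_of, (hy x).star_eq]

theorem eval_gen {B : Type w} [Ring B] [StarRing B] [Algebra ℂ B] [StarModule ℂ B] (y : S → B)
    (hy : ∀ x, IsSelfAdjoint (y x)) (x : S) : eval y hy (gen x) = y x := by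
  change MonoidAlgebra.lift ℂ B (FreeMonoid S) (FreeMonoid.lift y) _ = _
  simp [gen, word, MonoidAlgebra.lift_single]

end
end FreeStarAlg

section UniversalAlgebra
variable {U : Type u} {V : Type v} [Fintype U] [Fintype V]
open FreeStarAlg

/-- A C*-seminorm on the free *-algebra on the vertices that vanishes on the defining relations
of a `G`-projection family. -/
structure IsAdmissible (G : BipartiteGraph U V) (N : Seminorm ℂ (FreeStarAlg (U ⊕ V))) : Prop where
  mul_le : ∀ a b, N (a * b) ≤ N a * N b
  star_mul_self : ∀ a, N (star a * a) = N a ^ 2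
  idem : ∀ x, N (gen x * gen x - gen x) = 0
  sum_left : N (∑ u : U, gen (Sum.inl u) - 1) = 0
  sum_right : N (∑ v : V, gen (Sum.inr v) - 1) = 0
  mul_eq_zero : ∀ u v, (u, v) ∉ G.edges → N (gen (Sum.inl u) * gen (Sum.inr v)) = 0

namespace IsAdmissible
variable {G : BipartiteGraph U V} {N : Seminorm ℂ (FreeStarAlg (U ⊕ V))}

theorem one_le (h : IsAdmissible G N) : N 1 ≤ 1 := by
  have h1 := h.star_mul_self 1
  rw [star_one, one_mul] at h1
  nlinarith [apply_nonneg N 1]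

theorem gen_le (h : IsAdmissible G N) (x : U ⊕ V) : N (gen x) ≤ 1 := by
  have h1 := h.star_mul_self (gen x)
  rw [star_gen] at h1
  have h2 : N (gen x * gen x) ≤ N (gen x) := by
    have := map_add_le_add N (gen x * gen x - gen x) (gen x)
    rw [h.idem, sub_add_cancel, zero_add] at this
    exact this
  nlinarith [apply_nonneg N (gen x)]

theorem word_le (h : IsAdmissible G N) (m : FreeMonoid (U ⊕ V)) : N (word m) ≤ 1 := by
  induction m using FreeMonoid.inductionOn' with
  | one => exact h.one_le
  | of_mul x m ih =>
    rw [word_mul]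
    refine (h.mul_le _ _).trans ?_
    exact mul_le_one₀ (h.gen_le x) (apply_nonneg N _) ih

theorem star_eq (h : IsAdmissible G N) (a : FreeStarAlg (U ⊕ V)) : N (star a) = N a := by
  have key : ∀ a, N a ≤ N (star a) := fun a => by
    have h1 := h.star_mul_self a
    have h2 := h.mul_le (star a) a
    by_contra hlt
    push Not at hlt
    nlinarith [apply_nonneg N (star a)]
  exact le_antisymm (by simpa using key (star a)) (key a)

theorem zero (G : BipartiteGraph U V) : IsAdmissible G (0 : Seminorm ℂ (FreeStarAlg (U ⊕ V))) where
  mul_le := by simp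
  star_mul_self := by simp
  idem := by simp
  sum_left := by simp
  sum_right := by simp
  mul_eq_zero := by simp

theorem exists_bound (G : BipartiteGraph U V) (a : FreeStarAlg (U ⊕ V)) :
    ∃ C : ℝ, ∀ N, IsAdmissible G N → N a ≤ C := by
  refine FreeStarAlg.induction
    (P := fun a => ∃ C : ℝ, ∀ N, IsAdmissible G N → N a ≤ C) ?_ ?_ ?_ a
  · exact ⟨0, fun N _ => by simp⟩
  · rintro a b ⟨C, hC⟩ ⟨D, hD⟩
    exact ⟨C + D, fun N h => (map_add_le_add N a b).trans (add_le_add (hC N h) (hD N h))⟩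
  · intro c m
    refine ⟨‖c‖, fun N h => ?_⟩
    rw [map_smul_eq_mul]
    exact mul_le_of_le_one_right (norm_nonneg c) (h.word_le m)

end IsAdmissible

noncomputable section

/-- The largest admissible C*-seminorm. -/
def maxSeminorm (G : BipartiteGraph U V) (a : FreeStarAlg (U ⊕ V)) : ℝ :=
  ⨆ N : {N : Seminorm ℂ (FreeStarAlg (U ⊕ V)) // IsAdmissible G N}, N.1 a

namespace maxSeminorm
variable (G : BipartiteGraph U V)

instance : Nonempty {N : Seminorm ℂ (FreeStarAlg (U ⊕ V)) // IsAdmissible G N} :=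
  ⟨⟨0, IsAdmissible.zero G⟩⟩

variable {G}

theorem le_max {N : Seminorm ℂ (FreeStarAlg (U ⊕ V))} (h : IsAdmissible G N)
    (a : FreeStarAlg (U ⊕ V)) : N a ≤ maxSeminorm G a := by
  obtain ⟨C, hC⟩ := IsAdmissible.exists_bound G a
  exact le_ciSup (f := fun N : {N : Seminorm ℂ (FreeStarAlg (U ⊕ V)) // IsAdmissible G N} => N.1 a)
    ⟨C, by rintro _ ⟨N, rfl⟩; exact hC N.1 N.2⟩ ⟨N, h⟩

theorem max_le {a : FreeStarAlg (U ⊕ V)} {C : ℝ} (h : ∀ N, IsAdmissible G N → N a ≤ C) :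
    maxSeminorm G a ≤ C :=
  ciSup_le fun N => h N.1 N.2

theorem nonneg (a : FreeStarAlg (U ⊕ V)) : 0 ≤ maxSeminorm G a :=
  (apply_nonneg (0 : Seminorm ℂ (FreeStarAlg (U ⊕ V))) a).trans (le_max (IsAdmissible.zero G) a)

variable (G) in
/-- The largest admissible C*-seminorm as a bundled ring seminorm. -/
def ringSeminorm : RingSeminorm (FreeStarAlg (U ⊕ V)) where
  toFun := maxSeminorm G
  map_zero' := le_antisymm (max_le fun N _ => by simp) (nonneg _)
  add_le' a b := max_le fun N h =>
    (map_add_le_add N a b).trans (add_le_add (le_max h a) (le_max h b))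
  neg' a := by
    unfold maxSeminorm
    simp only [map_neg_eq_map]
  mul_le' a b := max_le fun N h => (h.mul_le a b).trans
    (mul_le_mul (le_max h a) (le_max h b) (apply_nonneg _ _) (nonneg _))

theorem smul_le (c : ℂ) (a : FreeStarAlg (U ⊕ V)) :
    maxSeminorm G (c • a) ≤ ‖c‖ * maxSeminorm G a :=
  max_le fun N h => by
    rw [map_smul_eq_mul]
    exact mul_le_mul_of_nonneg_left (le_max h a) (norm_nonneg c)

theorem star_eq (a : FreeStarAlg (U ⊕ V)) : maxSeminorm G (star a) = maxSeminorm G a :=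
  iSup_congr fun N => N.2.star_eq a

theorem sq_le (a : FreeStarAlg (U ⊕ V)) :
    maxSeminorm G a * maxSeminorm G a ≤ maxSeminorm G (star a * a) := by
  have h : maxSeminorm G a ≤ √(maxSeminorm G (star a * a)) := max_le fun N h => by
    apply Real.le_sqrt_of_sq_le
    rw [← h.star_mul_self]
    exact le_max h _
  calc _ ≤ √(maxSeminorm G (star a * a)) * √(maxSeminorm G (star a * a)) :=
        mul_le_mul h h (nonneg _) (Real.sqrt_nonneg _)
    _ = _ := Real.mul_self_sqrt (nonneg _)

theorem eq_zero {a : FreeStarAlg (U ⊕ V)} (h : ∀ N, IsAdmissible G N → N a = 0) :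
    maxSeminorm G a = 0 :=
  le_antisymm (max_le fun N hN => (h N hN).le) (nonneg _)

end maxSeminorm

/-- The free *-algebra on the vertices, with the largest admissible C*-seminorm as its seminorm. -/
def PreCStar (_G : BipartiteGraph U V) : Type (max u v) := FreeStarAlg (U ⊕ V)

namespace PreCStar
variable (G : BipartiteGraph U V)

instance : SeminormedRing (PreCStar G) := (maxSeminorm.ringSeminorm G).toSeminormedRing

instance : Algebra ℂ (PreCStar G) := inferInstanceAs (Algebra ℂ (FreeStarAlg (U ⊕ V)))
instance : StarRing (PreCStar G) := inferInstanceAs (StarRing (FreeStarAlg (U ⊕ V)))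
instance : StarModule ℂ (PreCStar G) := inferInstanceAs (StarModule ℂ (FreeStarAlg (U ⊕ V)))

instance : NormedAlgebra ℂ (PreCStar G) where
  norm_smul_le c a := maxSeminorm.smul_le (G := G) c a

theorem norm_star (a : PreCStar G) : ‖star a‖ = ‖a‖ := maxSeminorm.star_eq (G := G) a
theorem sq_le (a : PreCStar G) : ‖a‖ * ‖a‖ ≤ ‖star a * a‖ := maxSeminorm.sq_le (G := G) a

end PreCStar

/-- The C*-algebra `C*(G)`: the separated completion of the free *-algebra on the vertices for the
largest C*-seminorm that respects the relations. See `isProjectionFamily_p`,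
`topologicalClosure_adjoin` and `existsUnique_lift` for its universal property. -/
def CStarGraph (G : BipartiteGraph U V) : Type (max u v) :=
  UniformSpace.Completion (PreCStar G)

namespace CStarGraph
variable (G : BipartiteGraph U V)
open UniformSpace

instance : NormedRing (CStarGraph G) := inferInstanceAs (NormedRing (Completion (PreCStar G)))
instance : Algebra ℂ (CStarGraph G) := inferInstanceAs (Algebra ℂ (Completion (PreCStar G)))
instance : CompleteSpace (CStarGraph G) :=
  inferInstanceAs (CompleteSpace (Completion (PreCStar G)))

instance : NormedAlgebra ℂ (CStarGraph G) where
  norm_smul_le c a := norm_smul_le (α := ℂ) (β := Completion (PreCStar G)) c a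

/-- The map to the completion. -/
def ofPre : PreCStar G →+* CStarGraph G := Completion.coeRingHom

theorem norm_ofPre (a : PreCStar G) : ‖ofPre G a‖ = ‖a‖ := Completion.norm_coe a

theorem continuous_ofPre : Continuous (ofPre G) := Completion.continuous_coe _

theorem denseRange_ofPre : DenseRange (ofPre G) := Completion.denseRange_coe

theorem ofPre_smul (c : ℂ) (a : PreCStar G) : ofPre G (c • a) = c • ofPre G a :=
  Completion.coe_smul c a

instance : Star (CStarGraph G) where
  star := Completion.map (star : PreCStar G → PreCStar G)

theorem uniformContinuous_star : UniformContinuous (star : PreCStar G → PreCStar G) := by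
  refine (AddMonoidHomClass.isometry_of_norm (starAddEquiv (R := PreCStar G)) ?_).uniformContinuous
  exact fun a => PreCStar.norm_star G a

theorem continuous_star' : Continuous (star : CStarGraph G → CStarGraph G) :=
  Completion.continuous_map

theorem star_ofPre (a : PreCStar G) : star (ofPre G a) = ofPre G (star a) :=
  Completion.map_coe (uniformContinuous_star G) a

variable {G} in
theorem induction {P : CStarGraph G → Prop} (hc : IsClosed {a | P a}) (h : ∀ a, P (ofPre G a))
    (a : CStarGraph G) : P a :=
  Completion.induction_on a hc h

instance : StarRing (CStarGraph G) where
  star_involutive a := by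
    refine induction (P := fun a => star (star a) = a)
      (isClosed_eq ((continuous_star' G).comp (continuous_star' G)) continuous_id) (fun a => ?_) a
    rw [star_ofPre, star_ofPre, star_star]
  star_mul a b := by
    have hs := continuous_star' G
    refine induction (P := fun a => star (a * b) = star b * star a)
      (isClosed_eq (by fun_prop) (by fun_prop)) (fun a => ?_) a
    refine induction (P := fun b => star (ofPre G a * b) = star b * star (ofPre G a))
      (isClosed_eq (by fun_prop) (by fun_prop)) (fun b => ?_) b
    rw [← map_mul, star_ofPre, star_ofPre, star_ofPre, star_mul, map_mul]
  star_add a b := by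
    have hs := continuous_star' G
    refine induction (P := fun a => star (a + b) = star a + star b)
      (isClosed_eq (by fun_prop) (by fun_prop)) (fun a => ?_) a
    refine induction (P := fun b => star (ofPre G a + b) = star (ofPre G a) + star b)
      (isClosed_eq (by fun_prop) (by fun_prop)) (fun b => ?_) b
    rw [← map_add, star_ofPre, star_ofPre, star_ofPre, star_add, map_add]

instance : StarModule ℂ (CStarGraph G) where
  star_smul c a := by
    have hs := continuous_star' G
    refine induction (P := fun a => star (c • a) = star c • star a)
      (isClosed_eq (hs.comp (continuous_const_smul c)) ((continuous_const_smul _).comp hs))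
      (fun a => ?_) a
    rw [← ofPre_smul, star_ofPre, star_ofPre, star_smul, ofPre_smul]

instance : CStarRing (CStarGraph G) where
  norm_mul_self_le a := by
    have hs := continuous_star' G
    refine induction (P := fun a => ‖a‖ * ‖a‖ ≤ ‖star a * a‖)
      (isClosed_le (by fun_prop) (by fun_prop)) (fun a => ?_) a
    rw [star_ofPre, ← map_mul, norm_ofPre, norm_ofPre]
    exact PreCStar.sq_le G a

instance : CStarAlgebra (CStarGraph G) where

/-- The image of a noncommutative *-polynomial in the universal C*-algebra. -/
def ofFree : FreeStarAlg (U ⊕ V) →⋆ₐ[ℂ] CStarGraph G where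
  toFun a := ofPre G a
  map_one' := map_one (ofPre G)
  map_mul' a b := map_mul (ofPre G) a b
  map_zero' := map_zero (ofPre G)
  map_add' a b := map_add (ofPre G) a b
  commutes' _ := rfl
  map_star' a := (star_ofPre G a).symm

theorem norm_ofFree (a : FreeStarAlg (U ⊕ V)) : ‖ofFree G a‖ = maxSeminorm G a :=
  norm_ofPre G a

theorem denseRange_ofFree : DenseRange (ofFree G) := denseRange_ofPre G

/-- The universal generators. -/
def p (x : U ⊕ V) : CStarGraph G := ofFree G (gen x)

theorem ofFree_eq_zero {a : FreeStarAlg (U ⊕ V)} (h : ∀ N, IsAdmissible G N → N a = 0) :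
    ofFree G a = 0 := by
  rw [← norm_eq_zero, norm_ofFree]
  exact maxSeminorm.eq_zero h

theorem isProjectionFamily_p : IsProjectionFamily G (p G) where
  isStarProjection x := by
    refine ⟨?_, ?_⟩
    · have := ofFree_eq_zero G fun N h => h.idem x
      rwa [map_sub, map_mul, sub_eq_zero] at this
    · exact (map_star (ofFree G) _).symm.trans (congrArg (ofFree G) (star_gen x))
  sum_left := by
    have := ofFree_eq_zero G fun N h => h.sum_left
    rwa [map_sub, map_sum, map_one, sub_eq_zero] at this
  sum_right := by
    have := ofFree_eq_zero G fun N h => h.sum_right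
    rwa [map_sub, map_sum, map_one, sub_eq_zero] at this
  mul_eq_zero u v huv := by
    have := ofFree_eq_zero G fun N h => h.mul_eq_zero u v huv
    rwa [map_mul] at this

variable {G} {B : Type w} [CStarAlgebra B] {y : U ⊕ V → B}

/-- The seminorm `a ↦ ‖φ a‖`. -/
def pullback (B : Type w) [CStarAlgebra B] (φ : FreeStarAlg (U ⊕ V) →⋆ₐ[ℂ] B) :
    Seminorm ℂ (FreeStarAlg (U ⊕ V)) :=
  (normSeminorm ℂ B).comp (φ : FreeStarAlg (U ⊕ V) →ₗ[ℂ] B)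

theorem pullback_apply (φ : FreeStarAlg (U ⊕ V) →⋆ₐ[ℂ] B) (a : FreeStarAlg (U ⊕ V)) :
    pullback B φ a = ‖φ a‖ := rfl

/-- Evaluation of *-polynomials at a projection family. -/
def evalFree (hy : IsProjectionFamily G y) : FreeStarAlg (U ⊕ V) →⋆ₐ[ℂ] B :=
  FreeStarAlg.eval y fun x => (hy.isStarProjection x).isSelfAdjoint

theorem evalFree_gen (hy : IsProjectionFamily G y) (x : U ⊕ V) : evalFree hy (gen x) = y x :=
  FreeStarAlg.eval_gen _ _ x

theorem isAdmissible_pullback (hy : IsProjectionFamily G y) :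
    IsAdmissible G (pullback B (evalFree hy)) where
  mul_le a b := by simpa only [pullback_apply, map_mul] using norm_mul_le _ _
  star_mul_self a := by
    simp only [pullback_apply, map_mul, map_star]
    rw [CStarRing.norm_star_mul_self, sq]
  idem x := by
    rw [pullback_apply, map_sub, map_mul, evalFree_gen, norm_eq_zero, sub_eq_zero]
    exact (hy.isStarProjection x).isIdempotentElem
  sum_left := by
    rw [pullback_apply, map_sub, map_sum, map_one, norm_eq_zero, sub_eq_zero]
    simpa only [evalFree_gen] using hy.sum_left
  sum_right := by
    rw [pullback_apply, map_sub, map_sum, map_one, norm_eq_zero, sub_eq_zero]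
    simpa only [evalFree_gen] using hy.sum_right
  mul_eq_zero u v huv := by
    rw [pullback_apply, map_mul, norm_eq_zero, evalFree_gen, evalFree_gen]
    exact hy.mul_eq_zero u v huv

/-- Evaluation at a projection family, on the synonym that carries the universal seminorm. -/
def evalPre (hy : IsProjectionFamily G y) : PreCStar G →+* B :=
  (evalFree hy : FreeStarAlg (U ⊕ V) →+* B)

theorem continuous_evalPre (hy : IsProjectionFamily G y) : Continuous (evalPre hy) := by
  refine AddMonoidHomClass.continuous_of_bound (evalPre hy) 1 fun a => ?_
  rw [one_mul]
  exact maxSeminorm.le_max (isAdmissible_pullback hy) a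

/-- The continuous extension of the evaluation to `C*(G)`. -/
def liftRingHom (hy : IsProjectionFamily G y) : CStarGraph G →+* B :=
  Completion.extensionHom (evalPre hy) (continuous_evalPre hy)

theorem liftRingHom_ofFree (hy : IsProjectionFamily G y) (a : FreeStarAlg (U ⊕ V)) :
    liftRingHom hy (ofFree G a) = evalFree hy a :=
  Completion.extensionHom_coe (evalPre hy) (continuous_evalPre hy) a

theorem continuous_liftRingHom (hy : IsProjectionFamily G y) : Continuous (liftRingHom hy) :=
  Completion.continuous_extension (f := evalPre hy)

/-- The universal property: a `G`-projection family in a unital C*-algebra `B` induces a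
*-homomorphism to `B`. -/
def lift (hy : IsProjectionFamily G y) : CStarGraph G →⋆ₐ[ℂ] B where
  __ := liftRingHom hy
  commutes' c := by
    change liftRingHom hy (algebraMap ℂ (CStarGraph G) c) = algebraMap ℂ B c
    rw [← AlgHomClass.commutes (ofFree G) c, liftRingHom_ofFree, AlgHomClass.commutes]
  map_star' a := by
    have hs := continuous_star' G
    have hl := continuous_liftRingHom hy
    refine induction (P := fun a => liftRingHom hy (star a) = star (liftRingHom hy a))
      (isClosed_eq (by fun_prop) (by fun_prop)) (fun a => ?_) a
    have key : ∀ b : FreeStarAlg (U ⊕ V),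
        liftRingHom hy (star (ofFree G b)) = star (liftRingHom hy (ofFree G b)) := fun b => by
      rw [← map_star (ofFree G), liftRingHom_ofFree, liftRingHom_ofFree, map_star]
    exact key a

theorem lift_p (hy : IsProjectionFamily G y) (x : U ⊕ V) : lift hy (p G x) = y x :=
  (liftRingHom_ofFree hy (gen x)).trans (evalFree_gen hy x)

/-- The generators generate: the smallest closed *-subalgebra containing them is everything. -/
theorem topologicalClosure_adjoin :
    (StarAlgebra.adjoin ℂ (Set.range (p G))).topologicalClosure = ⊤ := by
  rw [eq_top_iff]
  intro a _
  refine closure_mono ?_ (denseRange_ofFree G a)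
  rintro _ ⟨a, rfl⟩
  refine FreeStarAlg.induction
    (P := fun a => ofFree G a ∈ StarAlgebra.adjoin ℂ (Set.range (p G))) ?_ ?_ ?_ a
  · rw [map_zero]; exact zero_mem _
  · intro a b ha hb
    rw [map_add]; exact add_mem ha hb
  · intro c m
    rw [map_smul]
    refine SMulMemClass.smul_mem c ?_
    induction m using FreeMonoid.inductionOn' with
    | one => rw [word_one, map_one]; exact one_mem _
    | of_mul x m ih =>
      rw [word_mul, map_mul]
      exact mul_mem (StarAlgebra.subset_adjoin ℂ _ ⟨x, rfl⟩) ih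

open scoped CStarAlgebra in
/-- `C*(G)` is the universal unital C*-algebra on a `G`-projection family. -/
theorem existsUnique_lift (hy : IsProjectionFamily G y) :
    ∃! φ : CStarGraph G →⋆ₐ[ℂ] B, ∀ x, φ (p G x) = y x := by
  refine ⟨lift hy, lift_p hy, fun φ hφ => ?_⟩
  have hle : StarAlgebra.adjoin ℂ (Set.range (p G)) ≤ StarAlgHom.equalizer φ (lift hy) := by
    refine StarAlgebra.adjoin_le ?_
    rintro _ ⟨x, rfl⟩
    exact (hφ x).trans (lift_p hy x).symm
  have hcl : IsClosed {a | φ a = lift hy a} := isClosed_eq (map_continuous φ) (map_continuous _)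
  refine StarAlgHom.ext fun a => ?_
  have ha : a ∈ (StarAlgebra.adjoin ℂ (Set.range (p G))).topologicalClosure :=
    topologicalClosure_adjoin (G := G) ▸ StarSubalgebra.mem_top
  exact closure_minimal (fun b hb => hle hb) hcl ha

end CStarGraph
end
end UniversalAlgebra

noncomputable section Spectrum

/-- An irreducible representation of a unital C*-algebra: a unital *-homomorphism to the bounded
operators on a nonzero Hilbert space without nontrivial closed invariant subspaces. -/
structure IrrRep (A : Type u) [CStarAlgebra A] where
  H : Type u
  [normedAddCommGroup : NormedAddCommGroup H]
  [innerProductSpace : InnerProductSpace ℂ H]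
  [completeSpace : CompleteSpace H]
  [nontrivial : Nontrivial H]
  toHom : A →⋆ₐ[ℂ] (H →L[ℂ] H)
  irreducible : ∀ W : Submodule ℂ H, IsClosed (W : Set H) →
    (∀ a, ∀ x ∈ W, toHom a x ∈ W) → W = ⊥ ∨ W = ⊤

attribute [instance] IrrRep.normedAddCommGroup IrrRep.innerProductSpace IrrRep.completeSpace
  IrrRep.nontrivial

namespace IrrRep
variable {A : Type u} [CStarAlgebra A]

/-- Unitary equivalence of representations. -/
def Equivalent (π ρ : IrrRep A) : Prop :=
  ∃ T : π.H ≃ₗᵢ[ℂ] ρ.H, ∀ a x, T (π.toHom a x) = ρ.toHom a (T x)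

theorem equivalent_equivalence : Equivalence (Equivalent (A := A)) where
  refl π := ⟨LinearIsometryEquiv.refl ℂ π.H, fun _ _ => rfl⟩
  symm := by
    rintro π ρ ⟨T, hT⟩
    refine ⟨T.symm, fun a x => ?_⟩
    rw [LinearIsometryEquiv.symm_apply_eq, hT, LinearIsometryEquiv.apply_symm_apply]
  trans := by
    rintro π ρ τ ⟨T, hT⟩ ⟨S, hS⟩
    exact ⟨T.trans S, fun a x => by simp [hT, hS]⟩

instance setoid (A : Type u) [CStarAlgebra A] : Setoid (IrrRep A) :=
  ⟨Equivalent, equivalent_equivalence⟩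

/-- The kernel of an irreducible representation. -/
def kernel (π : IrrRep A) : Ideal A := RingHom.ker π.toHom

theorem mem_kernel {π : IrrRep A} {a : A} : a ∈ π.kernel ↔ π.toHom a = 0 := Iff.rfl

theorem kernel_eq_of_equivalent {π ρ : IrrRep A} (h : Equivalent π ρ) : π.kernel = ρ.kernel := by
  obtain ⟨T, hT⟩ := h
  ext a
  rw [mem_kernel, mem_kernel]
  constructor
  · intro h
    ext x
    have := hT a (T.symm x)
    rw [h, LinearIsometryEquiv.apply_symm_apply] at this
    simpa using this.symm
  · intro h
    ext x
    have := hT a x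
    rw [h] at this
    simpa using this

theorem one_notMem_kernel (π : IrrRep A) : (1 : A) ∉ π.kernel := by
  rw [mem_kernel, map_one]
  exact one_ne_zero

/-- Kernels of irreducible representations are prime. -/
theorem exists_mul_mul_notMem (π : IrrRep A) {a b : A} (ha : a ∉ π.kernel) (hb : b ∉ π.kernel) :
    ∃ c, a * c * b ∉ π.kernel := by
  by_contra! h
  simp only [mem_kernel] at ha hb h
  obtain ⟨x, hx⟩ : ∃ x, π.toHom b x ≠ 0 := by
    by_contra! hx
    exact hb (ContinuousLinearMap.ext hx)
  -- the largest invariant subspace of the kernel of `π a`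
  let W : Submodule ℂ π.H :=
    { carrier := {y | ∀ c, π.toHom (a * c) y = 0}
      zero_mem' := fun c => map_zero _
      add_mem' := fun hy hz c => by rw [map_add, hy c, hz c, add_zero]
      smul_mem' := fun r y hy c => by rw [map_smul, hy c, smul_zero] }
  have hW : IsClosed (W : Set π.H) := by
    have : (W : Set π.H) = ⋂ c, {y | π.toHom (a * c) y = 0} := by
      ext y; simp [W]
    rw [this]
    exact isClosed_iInter fun c => isClosed_eq (π.toHom (a * c)).continuous continuous_const
  have hinv : ∀ d, ∀ y ∈ W, π.toHom d y ∈ W := fun d y hy c => by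
    have := hy (c * d)
    rwa [← mul_assoc, map_mul] at this
  rcases π.irreducible W hW hinv with h0 | h1
  · have hxW : π.toHom b x ∈ W := fun c => by
      have := congrArg (fun f => f x) (h c)
      simpa [map_mul] using this
    rw [h0] at hxW
    exact hx hxW
  · apply ha
    ext y
    have hy : y ∈ W := h1 ▸ Submodule.mem_top
    simpa using hy 1

end IrrRep

/-- The primitive ideals of a C*-algebra. -/
def Prim (A : Type u) [CStarAlgebra A] : Type u :=
  {I : Ideal A // ∃ π : IrrRep A, I = π.kernel}

/-- The hull-kernel topology: a set of primitive ideals is closed iff it contains every primitive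
ideal that contains the intersection of its members. -/
instance (A : Type u) [CStarAlgebra A] : TopologicalSpace (Prim A) :=
  TopologicalSpace.ofClosed {S : Set (Prim A) | ∀ I : Prim A, (⨅ J ∈ S, J.1) ≤ I.1 → I ∈ S}
    (by
      rintro ⟨_, π, rfl⟩ h
      exact absurd (h (by simp : (1 : A) ∈ _)) π.one_notMem_kernel)
    (by
      intro F hF I hI S hS
      refine hF hS I (le_trans (le_iInf₂ fun J hJ => ?_) hI)
      exact iInf₂_le J (hJ S hS))
    (by
      rintro S hS T hT I hI
      by_contra hST
      rw [Set.mem_union, not_or] at hST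
      obtain ⟨a, ha, haI⟩ := SetLike.not_le_iff_exists.1 fun h => hST.1 (hS I h)
      obtain ⟨b, hb, hbI⟩ := SetLike.not_le_iff_exists.1 fun h => hST.2 (hT I h)
      obtain ⟨I, π, rfl⟩ := I
      obtain ⟨c, hc⟩ := π.exists_mul_mul_notMem haI hbI
      refine hc (hI ?_)
      simp only [Submodule.mem_iInf] at ha hb ⊢
      rintro J (hJ | hJ)
      · obtain ⟨J, ρ, rfl⟩ := J
        have := ha _ hJ
        rw [IrrRep.mem_kernel] at this ⊢
        rw [map_mul, map_mul, this, zero_mul, zero_mul]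
      · exact J.1.mul_mem_left _ (hb _ hJ))

theorem Prim.mem_closure_iff {A : Type u} [CStarAlgebra A] (S : Set (Prim A)) (I : Prim A) :
    I ∈ closure S ↔ (⨅ J ∈ S, J.1) ≤ I.1 := by
  have hcl : ∀ T : Set (Prim A), IsClosed T ↔ ∀ I : Prim A, (⨅ J ∈ T, J.1) ≤ I.1 → I ∈ T :=
    fun T => by
      rw [← isOpen_compl_iff]
      change Tᶜᶜ ∈ {S : Set (Prim A) | ∀ I : Prim A, (⨅ J ∈ S, J.1) ≤ I.1 → I ∈ S} ↔ _
      rw [compl_compl]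
      rfl
  constructor
  · intro h
    obtain ⟨K, hK⟩ : ∃ K : Ideal A, K = ⨅ J ∈ S, J.1 := ⟨_, rfl⟩
    rw [← hK]
    have hT : IsClosed {I : Prim A | K ≤ I.1} := by
      rw [hcl]
      intro I hI
      refine le_trans (le_iInf fun J => le_iInf fun hJ => ?_) hI
      exact hJ
    refine closure_minimal (fun J hJ => ?_) hT h
    rw [hK]
    exact biInf_le (fun J : Prim A => J.1) hJ
  · intro h
    have hmono : (⨅ J ∈ closure S, J.1 : Ideal A) ≤ ⨅ J ∈ S, J.1 :=
      biInf_mono fun J hJ => subset_closure hJ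
    exact (hcl _).1 isClosed_closure I (hmono.trans h)

/-- The spectrum: irreducible representations up to unitary equivalence. -/
def Spec (A : Type u) [CStarAlgebra A] : Type (u + 1) := Quotient (IrrRep.setoid A)

namespace Spec
variable {A : Type u} [CStarAlgebra A]

/-- The class of an irreducible representation. -/
def mk (π : IrrRep A) : Spec A := Quotient.mk _ π

/-- The map from the spectrum to the primitive ideals that sends `[π]` to `ker π`. -/
def toPrim : Spec A → Prim A :=
  Quotient.lift (fun π => ⟨π.kernel, π, rfl⟩) fun _ _ h =>
    Subtype.ext (IrrRep.kernel_eq_of_equivalent h)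

/-- The coarsest topology for which `toPrim` is continuous. -/
instance : TopologicalSpace (Spec A) := TopologicalSpace.induced toPrim inferInstance

end Spec

/-- The subspace of (classes of) one- and two-dimensional irreducible representations. -/
def SpecLeTwo (A : Type u) [CStarAlgebra A] : Set (Spec A) :=
  {x | ∃ π : IrrRep A, Spec.mk π = x ∧ (Module.finrank ℂ π.H = 1 ∨ Module.finrank ℂ π.H = 2)}

end Spectrum

noncomputable section Representations

/-- The complete bipartite graph. -/
def completeBipartite (m n : ℕ) : BipartiteGraph (Fin m) (Fin n) where
  edges := Set.univ

/-- An isomorphism of bipartite graphs. -/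
structure BipartiteGraph.Iso {U : Type u} {V : Type v} {U' : Type w} {V' : Type z}
    (G : BipartiteGraph U V) (G' : BipartiteGraph U' V') where
  left : U ≃ U'
  right : V ≃ V'
  edges_iff : ∀ u v, (u, v) ∈ G.edges ↔ (left u, right v) ∈ G'.edges

/-- A subgraph: subsets of the two vertex sets, and a set of edges of `G` between them. -/
@[ext]
structure BipartiteGraph.Subgraph {U : Type u} {V : Type v} (G : BipartiteGraph U V) where
  left : Set U
  right : Set V
  edges : Set (U × V)
  edges_subset : edges ⊆ G.edges
  left_mem : ∀ e ∈ edges, e.1 ∈ left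
  right_mem : ∀ e ∈ edges, e.2 ∈ right

/-- A subgraph as a bipartite graph in its own right. -/
def BipartiteGraph.Subgraph.coe {U : Type u} {V : Type v} {G : BipartiteGraph U V}
    (H : G.Subgraph) : BipartiteGraph H.left H.right where
  edges := {e | ((e.1 : U), (e.2 : V)) ∈ H.edges}

/-- The subgraphs of `G` that are isomorphic to `K_{2,2}`. (Exchanging the two sides gives nothing
new, since `K_{2,2}` is symmetric.) -/
def K22Subgraph {U : Type u} {V : Type v} (G : BipartiteGraph U V) : Type (max u v) :=
  {H : G.Subgraph // Nonempty ((completeBipartite 2 2).Iso H.coe)}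

/-- A labelling `u₁, u₂, v₁, v₂` of the vertices of a `K_{2,2}`-subgraph. -/
abbrev K22Subgraph.Labelling {U : Type u} {V : Type v} {G : BipartiteGraph U V}
    (H : K22Subgraph G) : Type (max u v) := (completeBipartite 2 2).Iso H.1.coe

/-- Two distinct edges are adjacent if they have a vertex in common. -/
def EdgeAdjacent {U : Type u} {V : Type v} (e f : U × V) : Prop :=
  e ≠ f ∧ (e.1 = f.1 ∨ e.2 = f.2)

theorem IsProjectionFamily.map {U : Type u} {V : Type v} [Fintype U] [Fintype V]
    {G : BipartiteGraph U V} {B : Type w} {C : Type z} [Ring B] [StarRing B] [Algebra ℂ B]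
    [Ring C] [StarRing C] [Algebra ℂ C] {y : U ⊕ V → B} (hy : IsProjectionFamily G y)
    (φ : B →⋆ₐ[ℂ] C) : IsProjectionFamily G fun x => φ (y x) where
  isStarProjection x := by
    obtain ⟨h1, h2⟩ := hy.isStarProjection x
    exact ⟨h1.map φ, h2.map φ⟩
  sum_left := by rw [← map_sum, hy.sum_left, map_one]
  sum_right := by rw [← map_sum, hy.sum_right, map_one]
  mul_eq_zero u v h := by rw [← map_mul, hy.mul_eq_zero u v h, map_zero]

variable {U : Type u} {V : Type v} [Fintype U] [Fintype V] {G : BipartiteGraph U V}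

open Classical in
/-- The family `p_x ↦ 1` if `x ∈ e`, and `p_x ↦ 0` otherwise. -/
def edgeFamily (B : Type w) [Zero B] [One B] (e : U × V) : U ⊕ V → B
  | Sum.inl u => if u = e.1 then 1 else 0
  | Sum.inr v => if v = e.2 then 1 else 0

theorem isProjectionFamily_edgeFamily (B : Type w) [Ring B] [StarRing B] (e : G.edges) :
    IsProjectionFamily G (edgeFamily B e.1) where
  isStarProjection x := by
    rcases x with u | v <;> simp only [edgeFamily] <;> split_ifs
    · exact .one B
    · exact .zero B
    · exact .one B
    · exact .zero B
  sum_left := by classical simp only [edgeFamily, Finset.sum_ite_eq', Finset.mem_univ, if_true]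
  sum_right := by classical simp only [edgeFamily, Finset.sum_ite_eq', Finset.mem_univ, if_true]
  mul_eq_zero u v h := by
    simp only [edgeFamily]
    split_ifs with h1 h2
    · subst h1 h2
      exact absurd e.2 h
    all_goals simp

theorem submodule_eq_bot_or_top_of_finrank_one {E : Type w} [AddCommGroup E] [Module ℂ E]
    (h : Module.finrank ℂ E = 1) (W : Submodule ℂ E) : W = ⊥ ∨ W = ⊤ :=
  have : IsSimpleOrder (Submodule ℂ E) := is_simple_module_of_finrank_eq_one h
  eq_bot_or_eq_top W

/-- The one-dimensional representation of an edge. -/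
def edgeRep (e : G.edges) : IrrRep (CStarGraph G) where
  H := EuclideanSpace ℂ (ULift.{max u v} (Fin 1))
  toHom := CStarGraph.lift (isProjectionFamily_edgeFamily _ e)
  irreducible W _ _ := submodule_eq_bot_or_top_of_finrank_one
    (by rw [finrank_euclideanSpace, Fintype.card_ulift, Fintype.card_fin]) W

/-- The point `π_e` of the spectrum. -/
def piPt (e : G.edges) : SpecLeTwo (CStarGraph G) :=
  ⟨Spec.mk (edgeRep e), edgeRep e, rfl, Or.inl (by
    change Module.finrank ℂ (EuclideanSpace ℂ (ULift.{max u v} (Fin 1))) = 1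
    rw [finrank_euclideanSpace, Fintype.card_ulift, Fintype.card_fin])⟩

/-- The images of `p_{u₁}, p_{u₂}`. -/
def leftMatrix : Fin 2 → Matrix (Fin 2) (Fin 2) ℂ :=
  ![!![1, 0; 0, 0], !![0, 0; 0, 1]]

/-- The images of `p_{v₁}, p_{v₂}`. -/
def rightMatrix (t : ℝ) : Fin 2 → Matrix (Fin 2) (Fin 2) ℂ :=
  ![!![((1 - t : ℝ) : ℂ), (√(t * (1 - t)) : ℝ); (√(t * (1 - t)) : ℝ), (t : ℝ)],
    !![(t : ℂ), (-√(t * (1 - t)) : ℝ); (-√(t * (1 - t)) : ℝ), (1 - t : ℝ)]]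

open Classical in
/-- The family `u_i ↦ leftMatrix i`, `v_j ↦ rightMatrix t j`, and `x ↦ 0` for all other vertices. -/
def squareFamily {H : K22Subgraph G} (l : H.Labelling) (t : ℝ) :
    U ⊕ V → Matrix (Fin 2) (Fin 2) ℂ
  | Sum.inl u => ∑ i, if u = l.left i then leftMatrix i else 0
  | Sum.inr v => ∑ j, if v = l.right j then rightMatrix t j else 0


theorem isStarProjection_leftMatrix (i : Fin 2) : IsStarProjection (leftMatrix i) := by
  fin_cases i <;> refine ⟨?_, ?_⟩ <;> ext a b <;> fin_cases a <;> fin_cases b <;>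
    simp [leftMatrix, Matrix.mul_apply, Fin.sum_univ_two, Matrix.star_apply]

theorem isStarProjection_rightMatrix {t : ℝ} (ht : t ∈ Set.Ioo (0 : ℝ) 1) (j : Fin 2) :
    IsStarProjection (rightMatrix t j) := by
  have h : √(t * (1 - t)) * √(t * (1 - t)) = t * (1 - t) :=
    Real.mul_self_sqrt (mul_nonneg ht.1.le (sub_nonneg.2 ht.2.le))
  have h' : (√(t * (1 - t)) : ℂ) * (√(t * (1 - t)) : ℂ) = t * (1 - t) := by
    exact_mod_cast congrArg (fun r : ℝ => (r : ℂ)) h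
  obtain ⟨s, hs⟩ : ∃ s : ℝ, s = √(t * (1 - t)) := ⟨_, rfl⟩
  rw [← hs] at h'
  fin_cases j <;> refine ⟨?_, ?_⟩ <;> ext a b <;> fin_cases a <;> fin_cases b <;>
    simp [rightMatrix, ← hs, Matrix.mul_apply, Fin.sum_univ_two, Matrix.star_apply] <;>
    first | done | linear_combination h' | ring

theorem sum_leftMatrix : ∑ i, leftMatrix i = 1 := by
  ext a b
  fin_cases a <;> fin_cases b <;> simp [leftMatrix, Fin.sum_univ_two]

theorem sum_rightMatrix (t : ℝ) : ∑ j, rightMatrix t j = 1 := by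
  ext a b
  fin_cases a <;> fin_cases b <;> simp [rightMatrix, Fin.sum_univ_two]

theorem squareFamily_left {H : K22Subgraph G} (l : H.Labelling) (t : ℝ) (i : Fin 2) :
    squareFamily l t (Sum.inl (l.left i)) = leftMatrix i := by
  simp [squareFamily, Subtype.coe_inj]

theorem squareFamily_right {H : K22Subgraph G} (l : H.Labelling) (t : ℝ) (j : Fin 2) :
    squareFamily l t (Sum.inr (l.right j)) = rightMatrix t j := by
  simp [squareFamily, Subtype.coe_inj]

theorem squareFamily_of_notMem_left {H : K22Subgraph G} (l : H.Labelling) (t : ℝ) {u : U}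
    (hu : u ∉ H.1.left) : squareFamily l t (Sum.inl u) = 0 := by
  refine Finset.sum_eq_zero fun i _ => if_neg ?_
  rintro rfl
  exact hu (l.left i).2

theorem squareFamily_of_notMem_right {H : K22Subgraph G} (l : H.Labelling) (t : ℝ) {v : V}
    (hv : v ∉ H.1.right) : squareFamily l t (Sum.inr v) = 0 := by
  refine Finset.sum_eq_zero fun i _ => if_neg ?_
  rintro rfl
  exact hv (l.right i).2

theorem isProjectionFamily_squareFamily {H : K22Subgraph G} (l : H.Labelling) {t : ℝ}
    (ht : t ∈ Set.Ioo (0 : ℝ) 1) : IsProjectionFamily G (squareFamily l t) where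
  isStarProjection x := by
    rcases x with u | v
    · by_cases hu : u ∈ H.1.left
      · obtain ⟨i, hi⟩ := l.left.surjective ⟨u, hu⟩
        obtain rfl : (l.left i : U) = u := congrArg Subtype.val hi
        rw [squareFamily_left]
        exact isStarProjection_leftMatrix i
      · rw [squareFamily_of_notMem_left l t hu]
        exact .zero _
    · by_cases hv : v ∈ H.1.right
      · obtain ⟨i, hi⟩ := l.right.surjective ⟨v, hv⟩
        obtain rfl : (l.right i : V) = v := congrArg Subtype.val hi
        rw [squareFamily_right]
        exact isStarProjection_rightMatrix ht i
      · rw [squareFamily_of_notMem_right l t hv]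
        exact .zero _
  sum_left := by
    simp only [squareFamily]
    rw [Finset.sum_comm, ← sum_leftMatrix]
    refine Finset.sum_congr rfl fun i _ => ?_
    rw [Finset.sum_eq_single (l.left i : U)] <;> simp +contextual
  sum_right := by
    simp only [squareFamily]
    rw [Finset.sum_comm, ← sum_rightMatrix t]
    refine Finset.sum_congr rfl fun i _ => ?_
    rw [Finset.sum_eq_single (l.right i : V)] <;> simp +contextual
  mul_eq_zero u v huv := by
    by_cases hu : u ∈ H.1.left
    · by_cases hv : v ∈ H.1.right
      · obtain ⟨i, hi⟩ := l.left.surjective ⟨u, hu⟩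
        obtain ⟨j, hj⟩ := l.right.surjective ⟨v, hv⟩
        have := (l.edges_iff i j).1 trivial
        rw [hi, hj] at this
        exact absurd (H.1.edges_subset this) huv
      · rw [squareFamily_of_notMem_right l t hv, mul_zero]
    · rw [squareFamily_of_notMem_left l t hu, zero_mul]

/-- `M₂` acting on `ℂ²` (with a copy of `Fin 2` in the required universe as index set). -/
def matrixAction : Matrix (Fin 2) (Fin 2) ℂ →⋆ₐ[ℂ]
    (EuclideanSpace ℂ (ULift.{w} (Fin 2)) →L[ℂ] EuclideanSpace ℂ (ULift.{w} (Fin 2))) where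
  __ := (Matrix.toEuclideanCLM (n := ULift.{w} (Fin 2)) (𝕜 := ℂ)).toAlgEquiv.toAlgHom.comp
    (Matrix.reindexAlgEquiv ℂ ℂ Equiv.ulift.symm).toAlgHom
  map_star' M := map_star (Matrix.toEuclideanCLM (n := ULift.{w} (Fin 2)) (𝕜 := ℂ))
    (Matrix.reindexAlgEquiv ℂ ℂ Equiv.ulift.symm M)

theorem matrixAction_apply (M : Matrix (Fin 2) (Fin 2) ℂ)
    (x : EuclideanSpace ℂ (ULift.{w} (Fin 2))) (i : Fin 2) :
    matrixAction M x ⟨i⟩ = M i 0 * x ⟨0⟩ + M i 1 * x ⟨1⟩ := by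
  change ∑ j : ULift.{w} (Fin 2), M i j.down * x j = _
  rw [← Equiv.ulift.symm.sum_comp, Fin.sum_univ_two]
  rfl

theorem squareFamily_irreducible {t : ℝ} (ht : t ∈ Set.Ioo (0 : ℝ) 1)
    (W : Submodule ℂ (EuclideanSpace ℂ (ULift.{w} (Fin 2))))
    (hl : ∀ i, ∀ x ∈ W, matrixAction (leftMatrix i) x ∈ W)
    (hr : ∀ x ∈ W, matrixAction (rightMatrix t 0) x ∈ W) : W = ⊥ ∨ W = ⊤ := by
  have hs : (√(t * (1 - t)) : ℂ) ≠ 0 := by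
    rw [Ne, Complex.ofReal_eq_zero]
    exact (Real.sqrt_pos.2 (mul_pos ht.1 (sub_pos.2 ht.2))).ne'
  let b : Fin 2 → EuclideanSpace ℂ (ULift.{w} (Fin 2)) := fun i => EuclideanSpace.single ⟨i⟩ 1
  have ext' : ∀ x y : EuclideanSpace ℂ (ULift.{w} (Fin 2)), (∀ i, x ⟨i⟩ = y ⟨i⟩) → x = y :=
    fun x y h => PiLp.ext fun i => h i.down
  have hb : ∀ x i, matrixAction (leftMatrix i) x = x ⟨i⟩ • b i := fun x i => by
    refine ext' _ _ fun j => ?_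
    rw [matrixAction_apply]
    fin_cases i <;> fin_cases j <;> simp [leftMatrix, b]
  have hc : ∀ i j, i ≠ j → matrixAction (leftMatrix j) (matrixAction (rightMatrix t 0) (b i)) =
      (√(t * (1 - t)) : ℂ) • b j := fun i j hij => by
    rw [hb, matrixAction_apply]
    congr 1
    fin_cases i <;> fin_cases j <;> simp [rightMatrix, b] at hij ⊢
  by_cases h : ∀ x ∈ W, ∀ i, x ⟨i⟩ = 0
  · left
    rw [eq_bot_iff]
    exact fun x hx => ext' _ _ fun i => h x hx i
  · right
    push Not at h
    obtain ⟨x, hx, i, hi⟩ := h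
    have h1 : b i ∈ W := by
      have := hl i x hx
      rwa [hb, W.smul_mem_iff hi] at this
    have h2 : ∀ j, b j ∈ W := fun j => by
      by_cases hij : i = j
      · exact hij ▸ h1
      · have := hl j _ (hr _ h1)
        rwa [hc i j hij, W.smul_mem_iff hs] at this
    rw [eq_top_iff]
    intro y _
    have : y = y ⟨0⟩ • b 0 + y ⟨1⟩ • b 1 := by
      refine ext' _ _ fun j => ?_
      fin_cases j <;> simp [b]
    rw [this]
    exact W.add_mem (W.smul_mem _ (h2 0)) (W.smul_mem _ (h2 1))

/-- The two-dimensional representation of a `K_{2,2}`-subgraph with labelled vertices. -/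
def squareRep {H : K22Subgraph G} (l : H.Labelling) (t : Set.Ioo (0 : ℝ) 1) :
    IrrRep (CStarGraph G) where
  H := EuclideanSpace ℂ (ULift.{max u v} (Fin 2))
  toHom := CStarGraph.lift ((isProjectionFamily_squareFamily l t.2).map matrixAction)
  irreducible W _ hW := by
    refine squareFamily_irreducible t.2 W (fun i x hx => ?_) fun x hx => ?_
    · have := hW (CStarGraph.p G (Sum.inl (l.left i))) x hx
      rwa [CStarGraph.lift_p, squareFamily_left] at this
    · have := hW (CStarGraph.p G (Sum.inr (l.right 0))) x hx
      rwa [CStarGraph.lift_p, squareFamily_right] at this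

/-- The point `σ_{H,t}` of the spectrum. -/
def sigmaPt {H : K22Subgraph G} (l : H.Labelling) (t : Set.Ioo (0 : ℝ) 1) :
    SpecLeTwo (CStarGraph G) :=
  ⟨Spec.mk (squareRep l t), squareRep l t, rfl, Or.inr (by
    change Module.finrank ℂ (EuclideanSpace ℂ (ULift.{max u v} (Fin 2))) = 2
    rw [finrank_euclideanSpace, Fintype.card_ulift, Fintype.card_fin])⟩

/-- The set `{σ_{H,t} | 0 < t < 1}`. -/
def sigmaSet {H : K22Subgraph G} (l : H.Labelling) : Set (SpecLeTwo (CStarGraph G)) :=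
  Set.range (sigmaPt l)

/-- The set `X_H`: the points `π_e` for the edges `e` of `H`, and the points `σ_{H,t}`. -/
def XSet {H : K22Subgraph G} (l : H.Labelling) : Set (SpecLeTwo (CStarGraph G)) :=
  {x | ∃ e : G.edges, e.1 ∈ H.1.edges ∧ piPt e = x} ∪ sigmaSet l

end Representations

/-- The gluing relation on `[0,1] ⨿ [0,1]`: the two copies of `t` are identified for `0 < t < 1`. -/
inductive GlueRel : Set.Icc (0 : ℝ) 1 ⊕ Set.Icc (0 : ℝ) 1 → Set.Icc (0 : ℝ) 1 ⊕ Set.Icc (0 : ℝ) 1 →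
    Prop
  | glue (t : Set.Icc (0 : ℝ) 1) (h0 : 0 < (t : ℝ)) (h1 : (t : ℝ) < 1) :
      GlueRel (Sum.inl t) (Sum.inr t)

/-- The non-Hausdorff space `X`: the interval `(0,1)` with two end points at each end, with the
quotient topology. -/
abbrev SpaceX : Type := Quot GlueRel

/-! The topology is controlled by explicit elements of the algebra. The sets {π : π(a) ≠ 0} form a
basis of the spectrum (`Spec.exists_nonvanishing_subset`), and functional calculus shows that {π :
‖π(a)‖ > r} is open for self-adjoint `a` and `r ≥ 0` (`Spec.mk_mem_normGt`). So one only has to know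
where a few words in the generators vanish and how large they are.

Classification: projections with sum one are mutually orthogonal. If every p_u commutes with every
p_v, all generators lie in the commutant of an irreducible representation, hence are 0 or 1, and the
representation is some π_e. If p_u and p_v do not commute in dimension two, neither is scalar, so
exactly two complementary projections survive on each side. None of the four cross pairs commutes,
so all four are edges and span a K_{2,2}. Two noncommuting projections of the plane have, in a
suitable orthonormal basis, the matrices of σ_{H,t} (`IsStarProjection.exists_orthonormal_pair`).

Topology of X_H: the matrices of σ_{H,t} make sense for 0 ≤ t ≤ 1 and depend continuously on t
(`continuous_squareHom`). At t = 0 and t = 1 the representation splits into the characters of two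
opposite edges. Hence t ↦ σ_{H,t} has two continuous extensions to [0,1], one through the edges at
each left vertex (`SpecLeTwo.continuous_path`). Since p_u p_v p_u is mapped to (1 - t) p_u or t p_u,
its norm recovers t, and the open sets {‖p_u p_v p_u‖ > r} pull back to rays; so each path is an
embedding (`SpecLeTwo.isInducing_path`). Inside X_H its range is the open set where p_u does not
vanish, and the two open arcs overlap exactly in the points σ_{H,t}, which gives the space X.

Globally, the word p_{u₁} p_{v₁} p_{u₂} p_{v₂} is nonzero precisely on {σ_{H,t}}, so these intervals
are open. Adjacent edges of H are separated because the norms of their corners at σ_{H,t} are t and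
1 - t, which cannot both exceed 1/2. Opposite edges are the values of the two paths at the same end
point, so any neighbourhoods of them share points σ_{H,s}. -/

noncomputable section

open Topology
open scoped CStarAlgebra

/-! ### Open subsets of the spectrum -/

namespace Spec

variable {A : Type u} [CStarAlgebra A]

/-- The classes of representations that do not annihilate `a`. -/
def nonvanishing (a : A) : Set (Spec A) := {x | a ∉ x.toPrim.1}

theorem mk_mem_nonvanishing {a : A} {π : IrrRep A} :
    mk π ∈ nonvanishing a ↔ π.toHom a ≠ 0 := Iff.rfl

theorem isOpen_nonvanishing (a : A) : IsOpen (nonvanishing a) := by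
  refine isOpen_induced_iff.2 ⟨{I : Prim A | a ∉ I.1}, ?_, rfl⟩
  rw [← isClosed_compl_iff, ← closure_subset_iff_isClosed]
  intro I hI
  rw [Prim.mem_closure_iff] at hI
  simp only [Set.mem_compl_iff, Set.mem_ofPred_eq, not_not]
  refine hI ?_
  simp only [Submodule.mem_iInf]
  intro J hJ
  simpa using hJ

/-- Being outside the closed complement means, in the hull-kernel topology, that the intersection of
the kernels there is not contained in the kernel of x. Any element witnessing this works, so the
nonvanishing sets form a basis. -/
theorem exists_nonvanishing_subset {s : Set (Spec A)} (hs : IsOpen s) {x : Spec A} (hx : x ∈ s) :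
    ∃ a, x ∈ nonvanishing a ∧ nonvanishing a ⊆ s := by
  obtain ⟨T, hT, rfl⟩ := isOpen_induced_iff.1 hs
  have h : x.toPrim ∉ closure Tᶜ := by
    rw [hT.isClosed_compl.closure_eq]
    exact fun h => h hx
  rw [Prim.mem_closure_iff] at h
  obtain ⟨a, ha, hax⟩ := SetLike.not_le_iff_exists.1 h
  refine ⟨a, hax, fun y hy => ?_⟩
  by_contra hyT
  simp only [Submodule.mem_iInf] at ha
  exact hy (ha _ hyT)

/-- For self-adjoint `a`, the classes of representations `π` with `r < ‖π a‖`. -/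
def normGt (a : A) (r : ℝ) : Set (Spec A) :=
  nonvanishing (cfc (fun s : ℝ => max (|s| - r) 0) a)

theorem isOpen_normGt (a : A) (r : ℝ) : IsOpen (normGt a r) := isOpen_nonvanishing _

/-- A *-homomorphism commutes with functional calculus, and max(|s| - r, 0) vanishes on the spectrum
of π(a) exactly when the spectral radius, here the norm, is at most r. With `isOpen_normGt` this is
lower semicontinuity of π ↦ ‖π(a)‖. -/
theorem mk_mem_normGt {a : A} (ha : IsSelfAdjoint a) {r : ℝ} (hr : 0 ≤ r) {π : IrrRep A} :
    mk π ∈ normGt a r ↔ r < ‖π.toHom a‖ := by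
  have hπ : IsSelfAdjoint (π.toHom a) := ha.map π.toHom
  have hf : Continuous fun s : ℝ => max (|s| - r) 0 := by fun_prop
  have hc : Continuous π.toHom := map_continuous π.toHom
  rw [normGt, mk_mem_nonvanishing, StarAlgHom.map_cfc π.toHom _ a hf.continuousOn hc ha hπ,
    ← not_le, not_iff_not, ← norm_le_zero_iff,
    norm_cfc_le_iff _ _ le_rfl hf.continuousOn hπ]
  have h2 := norm_cfc_le_iff (id : ℝ → ℝ) (π.toHom a) hr continuousOn_id hπ
  rw [cfc_id ℝ (π.toHom a) hπ] at h2
  rw [h2]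
  refine forall₂_congr fun s _ => ?_
  simp

end Spec

/-! ### Representations of `C*(G)` -/

namespace CStarGraph

variable {U : Type u} {V : Type v} [Fintype U] [Fintype V] {G : BipartiteGraph U V}

/-- Intertwining passes from generators to words and linear combinations, and then to the closure,
which is all of C*(G). It serves for unitary equivalences, for subrepresentations and for
commutants. -/
theorem intertwines {H : Type w} {K : Type z} [NormedAddCommGroup H] [InnerProductSpace ℂ H]
    [CompleteSpace H] [NormedAddCommGroup K] [InnerProductSpace ℂ K] [CompleteSpace K]
    (π : CStarGraph G →⋆ₐ[ℂ] (H →L[ℂ] H)) (ρ : CStarGraph G →⋆ₐ[ℂ] (K →L[ℂ] K)) (T : H →L[ℂ] K)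
    (h : ∀ x, T ∘L π (p G x) = ρ (p G x) ∘L T) (a : CStarGraph G) :
    T ∘L π a = ρ a ∘L T := by
  have hπ : Continuous π := map_continuous π
  have hρ : Continuous ρ := map_continuous ρ
  refine (denseRange_ofFree G).induction_on (p := fun a => T ∘L π a = ρ a ∘L T) a
    (isClosed_eq (by fun_prop) (by fun_prop)) fun b => ?_
  refine FreeStarAlg.induction
    (P := fun b => T ∘L π (ofFree G b) = ρ (ofFree G b) ∘L T) ?_ ?_ ?_ b
  · simp
  · intro a b ha hb
    simp [ha, hb]
  · intro c m
    rw [map_smul, map_smul, map_smul, ContinuousLinearMap.comp_smul,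
      ContinuousLinearMap.smul_comp]
    congr 1
    induction m using FreeMonoid.inductionOn' with
    | one => rw [FreeStarAlg.word_one, map_one, map_one, map_one]; rfl
    | of_mul x m ih =>
      rw [FreeStarAlg.word_mul, map_mul, map_mul, map_mul]
      calc T ∘L π (p G x) ∘L π (ofFree G (FreeStarAlg.word m))
          = ρ (p G x) ∘L T ∘L π (ofFree G (FreeStarAlg.word m)) := by
            rw [← ContinuousLinearMap.comp_assoc, h, ContinuousLinearMap.comp_assoc]
        _ = _ := by rw [ih]; rfl

/-- The element `p_u p_v p_u`. -/
def corner (e : U × V) : CStarGraph G :=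
  p G (Sum.inl e.1) * p G (Sum.inr e.2) * p G (Sum.inl e.1)

theorem isSelfAdjoint_corner (e : U × V) : IsSelfAdjoint (corner (G := G) e) := by
  have h := fun x => ((isProjectionFamily_p G).isStarProjection x).isSelfAdjoint.star_eq
  rw [isSelfAdjoint_iff, corner, star_mul, star_mul, h, h, mul_assoc]

end CStarGraph

section Values

open CStarGraph

variable {U : Type u} {V : Type v} [Fintype U] [Fintype V] {G : BipartiteGraph U V}

/-! ### Vertices and edges of K_{2,2}-subgraphs -/

namespace K22Subgraph

variable {H H' : K22Subgraph G} (l : H.Labelling)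

theorem mem_left_iff (u : U) : u ∈ H.1.left ↔ ∃ i, (l.left i : U) = u := by
  refine ⟨fun hu => ?_, ?_⟩
  · obtain ⟨i, hi⟩ := l.left.surjective ⟨u, hu⟩
    exact ⟨i, by rw [hi]⟩
  · rintro ⟨i, rfl⟩
    exact (l.left i).2

theorem mem_right_iff (v : V) : v ∈ H.1.right ↔ ∃ i, (l.right i : V) = v := by
  refine ⟨fun hu => ?_, ?_⟩
  · obtain ⟨i, hi⟩ := l.right.surjective ⟨v, hu⟩
    exact ⟨i, by rw [hi]⟩
  · rintro ⟨i, rfl⟩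
    exact (l.right i).2

theorem edge_mem (i j : Fin 2) : ((l.left i : U), (l.right j : V)) ∈ H.1.edges :=
  (l.edges_iff i j).1 trivial

theorem mem_edges_iff (e : U × V) :
    e ∈ H.1.edges ↔ ∃ i j, e = ((l.left i : U), (l.right j : V)) := by
  refine ⟨fun he => ?_, ?_⟩
  · obtain ⟨i, hi⟩ := (mem_left_iff l _).1 (H.1.left_mem e he)
    obtain ⟨j, hj⟩ := (mem_right_iff l _).1 (H.1.right_mem e he)
    exact ⟨i, j, by rw [hi, hj]⟩
  · rintro ⟨i, j, rfl⟩
    exact edge_mem l i j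

theorem mem_edges_iff_mem (e : U × V) : e ∈ H.1.edges ↔ e.1 ∈ H.1.left ∧ e.2 ∈ H.1.right := by
  refine ⟨fun he => ⟨H.1.left_mem e he, H.1.right_mem e he⟩, fun ⟨h1, h2⟩ => ?_⟩
  obtain ⟨l⟩ := H.2
  obtain ⟨i, hi⟩ := (mem_left_iff l _).1 h1
  obtain ⟨j, hj⟩ := (mem_right_iff l _).1 h2
  exact (mem_edges_iff l e).2 ⟨i, j, by rw [hi, hj]⟩

theorem left_inj {i j : Fin 2} : (l.left i : U) = l.left j ↔ i = j := by
  rw [Subtype.coe_inj, l.left.injective.eq_iff]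

theorem right_inj {i j : Fin 2} : (l.right i : V) = l.right j ↔ i = j := by
  rw [Subtype.coe_inj, l.right.injective.eq_iff]

/-- Both vertex sets have two elements, so the inclusions are equalities, and completeness then
fixes the edges. Consequently a different K_{2,2} always misses a vertex of the given one. -/
theorem eq_of_subset (hl : H.1.left ⊆ H'.1.left) (hr : H.1.right ⊆ H'.1.right) : H = H' := by
  obtain ⟨k⟩ := H.2
  obtain ⟨k'⟩ := H'.2
  have hcard : ∀ (K : K22Subgraph G) (l : K.Labelling), K.1.left.ncard = 2 ∧ K.1.right.ncard = 2 :=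
    fun K l => by
      constructor
      · rw [← Nat.card_coe_set_eq, ← Nat.card_congr l.left, Nat.card_fin]
      · rw [← Nat.card_coe_set_eq, ← Nat.card_congr l.right, Nat.card_fin]
  have h1 : H.1.left = H'.1.left := Set.eq_of_subset_of_ncard_le hl
    (by rw [(hcard H k).1, (hcard H' k').1]) (Set.toFinite _)
  have h2 : H.1.right = H'.1.right := Set.eq_of_subset_of_ncard_le hr
    (by rw [(hcard H k).2, (hcard H' k').2]) (Set.toFinite _)
  refine Subtype.ext (BipartiteGraph.Subgraph.ext h1 h2 ?_)
  ext e
  rw [mem_edges_iff_mem, mem_edges_iff_mem, h1, h2]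

end K22Subgraph

/-! ### Values of the edge and square representations -/

open K22Subgraph

/-- The vertices of an edge. -/
def IsEndpoint (e : U × V) : U ⊕ V → Prop
  | Sum.inl u => u = e.1
  | Sum.inr v => v = e.2

open Classical in
theorem edgeFamily_eq (B : Type w) [Zero B] [One B] (e : U × V) (x : U ⊕ V) :
    edgeFamily B e x = if IsEndpoint e x then 1 else 0 := by
  rcases x with u | v <;> rfl

open Classical in
theorem edgeRep_p (e : G.edges) (x : U ⊕ V) :
    (edgeRep e).toHom (p G x) = if IsEndpoint e.1 x then 1 else 0 := by
  rw [← edgeFamily_eq]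
  exact lift_p _ x

open Classical in
theorem edgeRep_corner (e : G.edges) (f : U × V) :
    (edgeRep e).toHom (corner f) = if f = e.1 then 1 else 0 := by
  rw [corner, map_mul, map_mul, edgeRep_p, edgeRep_p]
  by_cases h1 : f.1 = e.1.1 <;> by_cases h2 : f.2 = e.1.2 <;>
    simp [IsEndpoint, Prod.ext_iff, h1, h2]

variable {H : K22Subgraph G} (l : H.Labelling)

theorem isStarProjection_rightMatrix_of_mem_Icc {t : ℝ} (ht : t ∈ Set.Icc (0 : ℝ) 1) (j : Fin 2) :
    IsStarProjection (rightMatrix t j) := by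
  rcases ht.1.eq_or_lt with rfl | h0
  · fin_cases j <;> refine ⟨?_, ?_⟩ <;> ext a b <;> fin_cases a <;> fin_cases b <;>
      simp [rightMatrix, Matrix.mul_apply, Fin.sum_univ_two, Matrix.star_apply]
  rcases ht.2.eq_or_lt with rfl | h1
  · fin_cases j <;> refine ⟨?_, ?_⟩ <;> ext a b <;> fin_cases a <;> fin_cases b <;>
      simp [rightMatrix, Matrix.mul_apply, Fin.sum_univ_two, Matrix.star_apply]
  · exact isStarProjection_rightMatrix ⟨h0, h1⟩ j

/-- The end points 0 and 1 are included so that limits of σ_{H,t} can be read off from an honest,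
though reducible, representation. -/
theorem isProjectionFamily_squareFamily_of_mem_Icc {t : ℝ} (ht : t ∈ Set.Icc (0 : ℝ) 1) :
    IsProjectionFamily G (squareFamily l t) where
  isStarProjection x := by
    rcases x with u | v
    -- The left projections do not depend on t, so any interior parameter serves.
    · exact (isProjectionFamily_squareFamily l
        (t := 1 / 2) ⟨by norm_num, by norm_num⟩).isStarProjection (Sum.inl u)
    · by_cases hv : v ∈ H.1.right
      · obtain ⟨i, rfl⟩ := (mem_right_iff l v).1 hv
        rw [squareFamily_right]
        exact isStarProjection_rightMatrix_of_mem_Icc ht i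
      · rw [squareFamily_of_notMem_right l t hv]
        exact .zero _
  sum_left := (isProjectionFamily_squareFamily l
    (t := 1 / 2) ⟨by norm_num, by norm_num⟩).sum_left
  sum_right := by
    simp only [squareFamily]
    rw [Finset.sum_comm, ← sum_rightMatrix t]
    refine Finset.sum_congr rfl fun i _ => ?_
    rw [Finset.sum_eq_single (l.right i : V)] <;> simp +contextual
  mul_eq_zero u v huv := by
    by_cases hu : u ∈ H.1.left
    · by_cases hv : v ∈ H.1.right
      · exact absurd (H.1.edges_subset ((mem_edges_iff_mem (u, v)).2 ⟨hu, hv⟩)) huv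
      · rw [squareFamily_of_notMem_right l t hv, mul_zero]
    · rw [squareFamily_of_notMem_left l t hu, zero_mul]

theorem continuous_rightMatrix (j : Fin 2) : Continuous fun t => rightMatrix t j := by
  fin_cases j <;> refine continuous_matrix fun a b => ?_ <;> fin_cases a <;> fin_cases b <;>
    simp only [rightMatrix] <;> simp <;> fun_prop

theorem continuous_squareFamily (x : U ⊕ V) : Continuous fun t => squareFamily l t x := by
  rcases x with u | v
  · exact continuous_const
  · by_cases hv : v ∈ H.1.right
    · obtain ⟨i, rfl⟩ := (mem_right_iff l v).1 hv
      simp only [squareFamily_right]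
      exact continuous_rightMatrix i
    · simp only [squareFamily_of_notMem_right l _ hv]
      exact continuous_const

theorem continuous_matrixAction : Continuous fun M => matrixAction.{w} M :=
  ((matrixAction.{w} : Matrix (Fin 2) (Fin 2) ℂ →⋆ₐ[ℂ] _).toAlgHom.toLinearMap
    ).continuous_of_finiteDimensional

/-- The bounded operators on the two-dimensional Hilbert space. -/
abbrev PlaneOperators : Type w :=
  EuclideanSpace ℂ (ULift.{w} (Fin 2)) →L[ℂ] EuclideanSpace ℂ (ULift.{w} (Fin 2))

/-- The representation `σ_{H,t}` for `0 ≤ t ≤ 1`. -/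
def squareHom (t : Set.Icc (0 : ℝ) 1) : CStarGraph G →⋆ₐ[ℂ] PlaneOperators.{max u v} :=
  CStarGraph.lift ((isProjectionFamily_squareFamily_of_mem_Icc l t.2).map matrixAction.{max u v})

theorem squareHom_p (t : Set.Icc (0 : ℝ) 1) (x : U ⊕ V) :
    squareHom l t (p G x) = matrixAction (squareFamily l t x) :=
  lift_p _ x

theorem continuous_squareHom_ofFree (a : FreeStarAlg (U ⊕ V)) :
    Continuous fun t => squareHom l t (ofFree G a) := by
  refine FreeStarAlg.induction
    (P := fun a => Continuous fun t => squareHom l t (ofFree G a)) ?_ ?_ ?_ a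
  · simp only [map_zero]
    exact continuous_const
  · intro a b ha hb
    simp only [map_add]
    exact ha.add hb
  · intro c m
    simp only [map_smul]
    refine Continuous.const_smul ?_ c
    induction m using FreeMonoid.inductionOn' with
    | one =>
      simp only [FreeStarAlg.word_one, map_one]
      exact continuous_const
    | of_mul x m ih =>
      simp only [FreeStarAlg.word_mul, map_mul]
      refine Continuous.mul ?_ ih
      have h : (fun t => squareHom l t (ofFree G (FreeStarAlg.word (FreeMonoid.of x)))) =
          fun t : Set.Icc (0 : ℝ) 1 => matrixAction (squareFamily l t x) :=
        funext fun t => squareHom_p l t x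
      rw [h]
      exact continuous_matrixAction.comp
        ((continuous_squareFamily l x).comp continuous_subtype_val)

/-- For polynomials in the generators continuity is read off from the matrices. As *-homomorphisms
are contractive, approximating `a` by polynomials is uniform in t. -/
theorem continuous_squareHom (a : CStarGraph G) : Continuous fun t => squareHom l t a := by
  refine continuous_of_uniform_approx_of_continuous fun s hs => ?_
  obtain ⟨ε, hε, h⟩ := Metric.mem_uniformity_dist.1 hs
  obtain ⟨b, hb⟩ := (denseRange_ofFree G).exists_dist_lt a hε
  refine ⟨_, continuous_squareHom_ofFree l b, fun t => h ?_⟩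
  refine lt_of_le_of_lt ?_ hb
  rw [dist_eq_norm, dist_eq_norm, ← map_sub]
  exact NonUnitalStarAlgHom.norm_apply_le (squareHom l t) _

theorem squareHom_corner (t : Set.Icc (0 : ℝ) 1) (e : U × V) :
    squareHom l t (corner e) = matrixAction (squareFamily l t (Sum.inl e.1) *
      squareFamily l t (Sum.inr e.2) * squareFamily l t (Sum.inl e.1)) := by
  rw [corner, map_mul, map_mul, squareHom_p, squareHom_p, map_mul, map_mul]

theorem squareHom_corner_of_notMem (t : Set.Icc (0 : ℝ) 1) {e : U × V} (he : e ∉ H.1.edges) :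
    squareHom l t (corner e) = 0 := by
  rw [squareHom_corner]
  rw [mem_edges_iff_mem, not_and_or] at he
  rcases he with h | h
  · rw [squareFamily_of_notMem_left l _ h, zero_mul, zero_mul, map_zero]
  · rw [squareFamily_of_notMem_right l _ h, mul_zero, zero_mul, map_zero]

theorem matrixAction_ne_zero {M : Matrix (Fin 2) (Fin 2) ℂ} (hM : M ≠ 0) :
    matrixAction.{w} M ≠ 0 := by
  contrapose! hM
  have key : ∀ i j, M i j = 0 := fun i j => by
    have h := matrixAction_apply M (EuclideanSpace.single (ULift.up j) 1) i
    rw [hM] at h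
    fin_cases j <;> simpa using h.symm
  ext i j
  exact key i j

theorem leftMatrix_ne_zero (i : Fin 2) : leftMatrix i ≠ 0 := by
  intro h
  have := congrFun (congrFun h i) i
  fin_cases i <;> simp [leftMatrix] at this

theorem norm_matrixAction_leftMatrix (i : Fin 2) : ‖matrixAction.{w} (leftMatrix i)‖ = 1 := by
  have h : IsStarProjection (matrixAction.{w} (leftMatrix i)) :=
    ⟨(isStarProjection_leftMatrix i).1.map _, (isStarProjection_leftMatrix i).2.map _⟩
  have h1 := CStarRing.norm_star_mul_self (x := matrixAction.{w} (leftMatrix i))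
  rw [h.isSelfAdjoint.star_eq, h.isIdempotentElem.eq] at h1
  have h2 : ‖matrixAction.{w} (leftMatrix i)‖ ≠ 0 :=
    norm_ne_zero_iff.2 (matrixAction_ne_zero (leftMatrix_ne_zero i))
  exact mul_left_cancel₀ h2 (by rw [← h1, mul_one])

/-- Compressing to the rank-one range of p_u leaves a scalar, the diagonal entry of p_v. This makes
the norm of p_u p_v p_u a coordinate function for t. -/
theorem leftMatrix_mul_rightMatrix_mul (t : ℝ) (i j : Fin 2) :
    leftMatrix i * rightMatrix t j * leftMatrix i =
      ((if i = j then 1 - t else t : ℝ) : ℂ) • leftMatrix i := by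
  ext a b
  fin_cases i <;> fin_cases j <;> fin_cases a <;> fin_cases b <;>
    simp [leftMatrix, rightMatrix, Matrix.mul_apply, Fin.sum_univ_two]

theorem norm_squareHom_corner (t : Set.Icc (0 : ℝ) 1) (i j : Fin 2) :
    ‖squareHom l t (corner ((l.left i : U), (l.right j : V)))‖ =
      if i = j then 1 - (t : ℝ) else t := by
  rw [squareHom_corner, squareFamily_left, squareFamily_right, leftMatrix_mul_rightMatrix_mul,
    map_smul, norm_smul, Complex.norm_real, norm_matrixAction_leftMatrix, mul_one,
    Real.norm_eq_abs, abs_of_nonneg]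
  split_ifs
  · linarith [t.2.2]
  · exact t.2.1

end Values

/-! ### Projections on Hilbert spaces of small dimension -/

section Projections

variable {H : Type w} [NormedAddCommGroup H] [InnerProductSpace ℂ H] [CompleteSpace H]
  {P Q : H →L[ℂ] H}

theorem IsStarProjection.inner_apply (hP : IsStarProjection P) (x y : H) :
    inner ℂ (P x) y = inner ℂ x (P y) :=
  ContinuousLinearMap.isSelfAdjoint_iff_isSymmetric.1 hP.isSelfAdjoint x y

theorem IsStarProjection.apply_apply (hP : IsStarProjection P) (x : H) : P (P x) = P x :=
  congrArg (fun f => f x) hP.isIdempotentElem.eq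

theorem IsStarProjection.inner_apply_self (hP : IsStarProjection P) (x : H) :
    inner ℂ (P x) x = (‖P x‖ : ℂ) ^ 2 := by
  rw [← hP.apply_apply, hP.inner_apply (P x) x, inner_self_eq_norm_sq_to_K, hP.apply_apply]
  rfl

theorem IsStarProjection.mul_eq_zero_comm (hP : IsStarProjection P) (hQ : IsStarProjection Q) :
    P * Q = 0 ↔ Q * P = 0 := by
  rw [← star_eq_zero, star_mul, hP.isSelfAdjoint.star_eq, hQ.isSelfAdjoint.star_eq]

variable {ι : Type z} [Fintype ι] {F : ι → H →L[ℂ] H}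

/-- For x in the range of `F j`, pairing the sum with x gives ∑ ‖F k x‖² = ‖x‖². The term k = j
already exhausts the right side, so `F i x = 0`. -/
theorem IsStarProjection.mul_eq_zero_of_sum_eq_one (hF : ∀ i, IsStarProjection (F i))
    (hs : ∑ i, F i = 1) {i j : ι} (hij : i ≠ j) : F i * F j = 0 := by
  classical
  ext y
  obtain ⟨x, hx⟩ : ∃ x, x = F j y := ⟨_, rfl⟩
  have hjx : F j x = x := by rw [hx, (hF j).apply_apply]
  have h1 : ∑ k, ‖F k x‖ ^ 2 = ‖x‖ ^ 2 := by
    have h : ∑ k, inner ℂ (F k x) x = inner ℂ x x := by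
      rw [← sum_inner, ← _root_.sum_apply, hs]
      rfl
    rw [inner_self_eq_norm_sq_to_K] at h
    simp only [(hF _).inner_apply_self] at h
    refine Complex.ofReal_injective ?_
    push_cast
    exact h
  have h2 : ‖F i x‖ ^ 2 + ‖F j x‖ ^ 2 ≤ ∑ k, ‖F k x‖ ^ 2 := by
    rw [← Finset.sum_pair (f := fun k => ‖F k x‖ ^ 2) hij]
    exact Finset.sum_le_sum_of_subset_of_nonneg (Finset.subset_univ _) fun _ _ _ => by positivity
  rw [h1, hjx] at h2
  have h3 : ‖F i x‖ = 0 := by nlinarith [norm_nonneg (F i x)]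
  simpa [hx] using h3

theorem eq_zero_of_finrank_two (hd : Module.finrank ℂ H = 2) {x y z : H} (hxy : inner ℂ x y = 0)
    (hxz : inner ℂ x z = 0) (hyz : inner ℂ y z = 0) : x = 0 ∨ y = 0 ∨ z = 0 := by
  by_contra! h
  have : FiniteDimensional ℂ H := FiniteDimensional.of_finrank_pos (by omega)
  have hli : LinearIndependent ℂ ![x, y, z] := by
    refine linearIndependent_of_ne_zero_of_inner_eq_zero (𝕜 := ℂ) ?_ ?_
    · intro i
      fin_cases i
      exacts [h.1, h.2.1, h.2.2]
    · intro i j hij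
      fin_cases i <;> fin_cases j <;>
        first
          | exact absurd rfl hij
          | assumption
          | (apply inner_eq_zero_symm.1; assumption)
  have := hli.fintype_card_le_finrank
  simp [hd] at this

/-- The ranges are mutually orthogonal, so a plane has room for at most two nonzero projections; a
second one must occur because `F i` is not 1. -/
theorem IsStarProjection.exists_pair_of_finrank_two (hd : Module.finrank ℂ H = 2)
    (hF : ∀ i, IsStarProjection (F i)) (hs : ∑ i, F i = 1) {i : ι} (h0 : F i ≠ 0) (h1 : F i ≠ 1) :
    ∃ j, i ≠ j ∧ F i + F j = 1 ∧ ∀ k, k ≠ i → k ≠ j → F k = 0 := by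
  classical
  obtain ⟨j, hij, hj⟩ : ∃ j, i ≠ j ∧ F j ≠ 0 := by
    by_contra! h
    refine h1 ?_
    rw [← hs, Finset.sum_eq_single i (fun j _ hj => h j hj.symm) (by simp)]
  have horth : ∀ a b, a ≠ b → ∀ x y, inner ℂ (F a x) (F b y) = 0 := fun a b hab x y => by
    rw [(hF a).inner_apply]
    have := congrArg (fun f => f y) (mul_eq_zero_of_sum_eq_one hF hs hab)
    rw [show F a (F b y) = 0 from this, inner_zero_right]
  have hz : ∀ k, k ≠ i → k ≠ j → F k = 0 := by
    intro k hki hkj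
    by_contra hk
    obtain ⟨x, hx⟩ := DFunLike.ne_iff.1 h0
    obtain ⟨y, hy⟩ := DFunLike.ne_iff.1 hj
    obtain ⟨z, hz⟩ := DFunLike.ne_iff.1 hk
    rcases eq_zero_of_finrank_two hd (horth i j hij x y) (horth i k hki.symm x z)
      (horth j k hkj.symm y z) with h | h | h
    exacts [hx h, hy h, hz h]
  refine ⟨j, hij, ?_, hz⟩
  rw [← hs, ← Finset.sum_pair hij]
  refine Finset.sum_subset (Finset.subset_univ _) fun k _ hk => ?_
  simp only [Finset.mem_insert, Finset.mem_singleton, not_or] at hk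
  exact hz k hk.1 hk.2

/-- Two noncommuting projections do not both annihilate or fix all vectors in the range of one of
them. -/
theorem IsStarProjection.exists_unit_vector (hP : IsStarProjection P) (hQ : IsStarProjection Q)
    (h : P * Q ≠ Q * P) : ∃ w, ‖w‖ = 1 ∧ Q w = w ∧ P w ≠ 0 ∧ P w ≠ w := by
  -- If this vanished, so would its adjoint (1 - P)QP, and then PQ = PQP = QP.
  have h1 : P * Q * (1 - P) ≠ 0 := by
    intro h0
    refine h ?_
    have h2 : (1 - P) * Q * P = 0 := by
      have := congrArg star h0
      simpa [star_mul, hP.isSelfAdjoint.star_eq, hQ.isSelfAdjoint.star_eq, mul_assoc] using this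
    have h3 : P * Q = P * Q * P := by
      rw [← sub_eq_zero, ← h0]; noncomm_ring
    have h4 : Q * P = P * Q * P := by
      rw [← sub_eq_zero, ← h2]; noncomm_ring
    rw [h3, ← h4]
  obtain ⟨y, hy⟩ := DFunLike.ne_iff.1 h1
  obtain ⟨z, hz⟩ : ∃ z, z = y - P y := ⟨_, rfl⟩
  obtain ⟨w, hw⟩ : ∃ w, w = Q z := ⟨_, rfl⟩
  have hPw : P w ≠ 0 := by simpa [hw, hz] using hy
  have hPz : P z = 0 := by rw [hz, map_sub, hP.apply_apply, sub_self]
  -- With z in the kernel of P, a vector w = Qz fixed by P would be orthogonal to z, whereas ⟨Qz, z⟩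
  -- = ‖w‖².
  have hPw' : P w ≠ w := by
    intro hfix
    refine hPw ?_
    have h2 : inner ℂ w z = 0 := by rw [← hfix, hP.inner_apply, hPz, inner_zero_right]
    rw [hw, hQ.inner_apply_self, ← hw] at h2
    have : w = 0 := by simpa using h2
    rw [this, map_zero]
  have hw0 : w ≠ 0 := by rintro rfl; exact hPw (map_zero _)
  have hc : ((‖w‖ : ℂ)⁻¹) ≠ 0 := by simpa using hw0
  refine ⟨(‖w‖ : ℂ)⁻¹ • w, ?_, ?_, ?_, ?_⟩
  · exact norm_smul_inv_norm hw0
  · rw [map_smul, hw, hQ.apply_apply]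
  · rw [map_smul]
    exact smul_ne_zero hc hPw
  · rw [map_smul]
    exact fun h => hPw' (smul_right_injective H hc h)

/-- A pair of noncommuting projections on a two-dimensional space in normal form. -/
theorem IsStarProjection.exists_orthonormal_pair (hd : Module.finrank ℂ H = 2)
    (hP : IsStarProjection P) (hQ : IsStarProjection Q) (h : P * Q ≠ Q * P) :
    ∃ (t : Set.Ioo (0 : ℝ) 1) (e f : H), Orthonormal ℂ ![e, f] ∧ P e = e ∧ P f = 0 ∧
      Q e = ((1 - t : ℝ) : ℂ) • e + ((√(t * (1 - t)) : ℝ) : ℂ) • f ∧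
      Q f = ((√(t * (1 - t)) : ℝ) : ℂ) • e + ((t : ℝ) : ℂ) • f := by
  obtain ⟨w, hw1, hQw, hw2, hw3⟩ := hP.exists_unit_vector hQ h
  obtain ⟨a, ha⟩ : ∃ a, a = ‖P w‖ := ⟨_, rfl⟩
  obtain ⟨b, hb⟩ : ∃ b, b = ‖w - P w‖ := ⟨_, rfl⟩
  have ha0 : 0 < a := ha ▸ norm_pos_iff.2 hw2
  have hb0 : 0 < b := hb ▸ norm_pos_iff.2 (sub_ne_zero.2 hw3.symm)
  have hPf : P (w - P w) = 0 := by rw [map_sub, hP.apply_apply, sub_self]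
  have horth : inner ℂ (P w) (w - P w) = 0 := by
    rw [hP.inner_apply, hPf, inner_zero_right]
  have hab : a ^ 2 + b ^ 2 = 1 := by
    have := norm_add_sq_eq_norm_sq_add_norm_sq_of_inner_eq_zero (𝕜 := ℂ) _ _ horth
    rw [add_sub_cancel, hw1, ← ha, ← hb] at this
    linarith
  -- Dividing the two components of w by their positive norms absorbs all phases: w = a e + b f with
  -- a, b > 0, so the off-diagonal entry of Q comes out as the positive number ab.
  obtain ⟨e, he⟩ : ∃ e, e = (a : ℂ)⁻¹ • P w := ⟨_, rfl⟩
  obtain ⟨f, hf⟩ : ∃ f, f = (b : ℂ)⁻¹ • (w - P w) := ⟨_, rfl⟩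
  have hac : (a : ℂ) ≠ 0 := by exact_mod_cast ha0.ne'
  have hbc : (b : ℂ) ≠ 0 := by exact_mod_cast hb0.ne'
  have hPe : P e = e := by rw [he, map_smul, hP.apply_apply]
  have hPf' : P f = 0 := by rw [hf, map_smul, hPf, smul_zero]
  have hne : ‖e‖ = 1 := by rw [he, ha]; exact norm_smul_inv_norm hw2
  have hnf : ‖f‖ = 1 := by rw [hf, hb]; exact norm_smul_inv_norm (sub_ne_zero.2 hw3.symm)
  have hef : inner ℂ e f = 0 := by
    rw [← hPe, hP.inner_apply, hPf', inner_zero_right]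
  have hfe : inner ℂ f e = 0 := inner_eq_zero_symm.1 hef
  have hw : w = (a : ℂ) • e + (b : ℂ) • f := by
    rw [he, hf, smul_smul, smul_smul, mul_inv_cancel₀ hac, mul_inv_cancel₀ hbc]
    simp
  obtain ⟨g, hg⟩ : ∃ g, g = (b : ℂ) • e - (a : ℂ) • f := ⟨_, rfl⟩
  have habc : (a : ℂ) ^ 2 + (b : ℂ) ^ 2 = 1 := by exact_mod_cast hab
  have he' : e = (a : ℂ) • w + (b : ℂ) • g := by
    rw [hw, hg]
    calc e = ((a : ℂ) ^ 2 + (b : ℂ) ^ 2) • e := by rw [habc, one_smul]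
      _ = _ := by module
  have hf' : f = (b : ℂ) • w - (a : ℂ) • g := by
    rw [hw, hg]
    calc f = ((a : ℂ) ^ 2 + (b : ℂ) ^ 2) • f := by rw [habc, one_smul]
      _ = _ := by module
  have hwg : inner ℂ w g = 0 := by
    rw [hw, hg]
    simp [hef, hfe, inner_self_eq_norm_sq_to_K, hne, hnf]
    ring
  -- The vectors w, Qg and g - Qg are pairwise orthogonal in a plane, so one is zero. If g = Qg,
  -- then Q fixes both w and g, hence Q = 1, which would commute with P.
  have hQg : Q g = 0 := by
    have hwQ : inner ℂ w (Q g) = 0 := by rw [← hQ.inner_apply, hQw, hwg]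
    have hz : inner ℂ (Q g) (g - Q g) = 0 := by
      rw [hQ.inner_apply, map_sub, hQ.apply_apply, sub_self, inner_zero_right]
    rcases eq_zero_of_finrank_two hd hwQ (by rw [inner_sub_right, hwg, hwQ, sub_zero]) hz with
      h0 | h0 | h0
    · rw [h0] at hw1; simp at hw1
    · exact h0
    · exfalso
      rw [sub_eq_zero] at h0
      have hQ1 : Q = 1 := by
        refine ContinuousLinearMap.ext fun x => ?_
        have hQx : Q (x - Q x) = 0 := by rw [map_sub, hQ.apply_apply, sub_self]
        have h1 : inner ℂ w (x - Q x) = 0 := by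
          rw [← hQw, hQ.inner_apply, hQx, inner_zero_right]
        have h2 : inner ℂ g (x - Q x) = 0 := by
          rw [h0, hQ.inner_apply, hQx, inner_zero_right]
        rcases eq_zero_of_finrank_two hd hwg h1 h2 with h3 | h3 | h3
        · rw [h3] at hw1; simp at hw1
        · exfalso
          have := congrArg (fun x => inner ℂ e x) hg
          simp only [h3, inner_zero_right, inner_sub_right, inner_smul_right, hef,
            inner_self_eq_norm_sq_to_K, hne] at this
          simp [hbc.symm] at this
        · exact (sub_eq_zero.1 h3).symm
      exact h (by rw [hQ1, mul_one, one_mul])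
  have hsqrt : √(b ^ 2 * (1 - b ^ 2)) = a * b := by
    rw [← hab, add_sub_cancel_right, ← mul_pow, Real.sqrt_sq (by positivity), mul_comm]
  have h1b : (1 - b ^ 2 : ℝ) = a ^ 2 := by linarith
  -- Since Q is the projection onto the line of w = a e + b f, its diagonal entries are a² and b²;
  -- the lower one is t.
  refine ⟨⟨b ^ 2, by positivity, by nlinarith⟩, e, f, ?_, hPe, hPf', ?_, ?_⟩
  · refine ⟨fun i => ?_, fun i j hij => ?_⟩
    · fin_cases i
      exacts [hne, hnf]
    · fin_cases i <;> fin_cases j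
      exacts [absurd rfl hij, hef, hfe, absurd rfl hij]
  · have : Q e = (a : ℂ) • w := by
      conv_lhs => rw [he']
      rw [map_add, map_smul, map_smul, hQw, hQg, smul_zero, add_zero]
    rw [hsqrt, h1b, this]
    simp only [hw, smul_add, smul_smul]
    push_cast
    rw [sq]
  · have : Q f = (b : ℂ) • w := by
      conv_lhs => rw [hf']
      rw [map_sub, map_smul, map_smul, hQw, hQg, smul_zero, sub_zero]
    simp only [hsqrt, this, hw, smul_add, smul_smul]
    push_cast
    rw [sq, mul_comm (b : ℂ) a]

end Projections

/-! ### The representations of dimension one and two -/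

section Classification

open CStarGraph K22Subgraph

variable {U : Type u} {V : Type v} [Fintype U] [Fintype V] {G : BipartiteGraph U V}

/-! ### Representations with commuting generators -/

/-- The isometry that maps the line onto the span of a unit vector. -/
def lineIsometry {K : Type z} [NormedAddCommGroup K] [InnerProductSpace ℂ K] (x : K)
    (hx : ‖x‖ = 1) : EuclideanSpace ℂ (ULift.{w} (Fin 1)) →ₗᵢ[ℂ] K where
  toFun y := y ⟨0⟩ • x
  map_add' y z := add_smul (y ⟨0⟩) (z ⟨0⟩) x
  map_smul' c y := mul_smul c (y ⟨0⟩) x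
  norm_map' y := by
    change ‖y ⟨0⟩ • x‖ = ‖y‖
    rw [norm_smul, hx, mul_one, EuclideanSpace.norm_eq, Fintype.sum_unique,
      Real.sqrt_sq (norm_nonneg _)]
    rfl

theorem lineIsometry_apply {K : Type z} [NormedAddCommGroup K] [InnerProductSpace ℂ K] (x : K)
    (hx : ‖x‖ = 1) (y : EuclideanSpace ℂ (ULift.{w} (Fin 1))) :
    lineIsometry x hx y = y ⟨0⟩ • x := rfl

/-- A joint eigenvector of the generators, with the eigenvalues prescribed by e, spans a copy of
π_e. This gives the classification in dimension one and also the splitting of the square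
representation at t = 0 and t = 1. -/
theorem lineIsometry_edgeRep {K : Type z} [NormedAddCommGroup K] [InnerProductSpace ℂ K]
    [CompleteSpace K] (ρ : CStarGraph G →⋆ₐ[ℂ] (K →L[ℂ] K)) (e : G.edges) (x : K) (hx : ‖x‖ = 1)
    (h : ∀ y, ρ (p G y) x = edgeFamily ℂ e.1 y • x) (a : CStarGraph G) (y : (edgeRep e).H) :
    lineIsometry x hx ((edgeRep e).toHom a y) = ρ a (lineIsometry x hx y) := by
  classical
  refine congrArg (fun f => f y)
    (intertwines (edgeRep e).toHom ρ (lineIsometry x hx).toContinuousLinearMap (fun z => ?_) a)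
  refine ContinuousLinearMap.ext fun y => ?_
  change lineIsometry x hx ((edgeRep e).toHom (p G z) y) = ρ (p G z) (lineIsometry x hx y)
  rw [lineIsometry_apply x hx y, map_smul, h, edgeRep_p, edgeFamily_eq]
  split_ifs
  · rw [one_smul]; rfl
  · rw [zero_smul, smul_zero]; exact map_zero _

theorem IrrRep.isStarProjection_p (π : IrrRep (CStarGraph G)) (x : U ⊕ V) :
    IsStarProjection (π.toHom (p G x)) :=
  ((isProjectionFamily_p G).map π.toHom).isStarProjection x

/-- A projection in the commutant of an irreducible representation is trivial. -/
theorem IrrRep.eq_zero_or_eq_one (π : IrrRep (CStarGraph G)) {P : π.H →L[ℂ] π.H}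
    (hP : IsStarProjection P) (h : ∀ x, P * π.toHom (p G x) = π.toHom (p G x) * P) :
    P = 0 ∨ P = 1 := by
  have hcomm : ∀ a y, P (π.toHom a y) = π.toHom a (P y) := fun a y =>
    congrArg (fun f => f y) (intertwines π.toHom π.toHom P h a)
  rcases π.irreducible (LinearMap.ker P.toLinearMap) P.isClosed_ker
    (fun a x hx => by
      have hx' : P x = 0 := hx
      change P (π.toHom a x) = 0
      rw [hcomm, hx', map_zero]) with h0 | h0
  · right
    refine ContinuousLinearMap.ext fun x => ?_
    have : x - P x ∈ LinearMap.ker P.toLinearMap := by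
      change P (x - P x) = 0
      rw [map_sub, hP.apply_apply, sub_self]
    rw [h0, Submodule.mem_bot, sub_eq_zero] at this
    exact this.symm
  · left
    refine ContinuousLinearMap.ext fun x => ?_
    have : x ∈ LinearMap.ker P.toLinearMap := h0 ▸ Submodule.mem_top
    exact this

/-- Generators on the same side are orthogonal and those on opposite sides commute by hypothesis, so
each lies in the commutant and is 0 or 1. On each side the sum condition and orthogonality leave
exactly one equal to 1, and these two have nonzero product, so they form an edge. -/
theorem IrrRep.exists_edge_of_commute (π : IrrRep (CStarGraph G))
    (h : ∀ u v, Commute (π.toHom (p G (Sum.inl u))) (π.toHom (p G (Sum.inr v)))) :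
    ∃ e : G.edges, ∀ x, π.toHom (p G x) = edgeFamily (π.H →L[ℂ] π.H) e.1 x := by
  classical
  have hF := (isProjectionFamily_p G).map π.toHom
  have hl : ∀ u u' : U, u ≠ u' → π.toHom (p G (Sum.inl u)) * π.toHom (p G (Sum.inl u')) = 0 :=
    fun u u' huu' => IsStarProjection.mul_eq_zero_of_sum_eq_one
      (F := fun u => π.toHom (p G (Sum.inl u))) (fun u => hF.isStarProjection _) hF.sum_left huu'
  have hr : ∀ v v' : V, v ≠ v' → π.toHom (p G (Sum.inr v)) * π.toHom (p G (Sum.inr v')) = 0 :=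
    fun v v' hvv' => IsStarProjection.mul_eq_zero_of_sum_eq_one
      (F := fun v => π.toHom (p G (Sum.inr v))) (fun v => hF.isStarProjection _) hF.sum_right hvv'
  have h01 : ∀ x, π.toHom (p G x) = 0 ∨ π.toHom (p G x) = 1 := fun x => by
    refine π.eq_zero_or_eq_one (hF.isStarProjection x) fun y => ?_
    rcases x with u | v <;> rcases y with u' | v'
    · rcases eq_or_ne u u' with rfl | hne
      · rfl
      · rw [hl _ _ hne, hl _ _ hne.symm]
    · exact h u v'
    · exact (h u' v).symm
    · rcases eq_or_ne v v' with rfl | hne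
      · rfl
      · rw [hr _ _ hne, hr _ _ hne.symm]
  obtain ⟨u, hu⟩ : ∃ u, π.toHom (p G (Sum.inl u)) = 1 := by
    by_contra! hne
    have := hF.sum_left
    rw [Finset.sum_eq_zero fun u _ => (h01 (Sum.inl u)).resolve_right (hne u)] at this
    exact zero_ne_one this
  obtain ⟨v, hv⟩ : ∃ v, π.toHom (p G (Sum.inr v)) = 1 := by
    by_contra! hne
    have := hF.sum_right
    rw [Finset.sum_eq_zero fun v _ => (h01 (Sum.inr v)).resolve_right (hne v)] at this
    exact zero_ne_one this
  have huv : (u, v) ∈ G.edges := by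
    by_contra hne
    have := hF.mul_eq_zero u v hne
    rw [hu, hv, mul_one] at this
    exact one_ne_zero this
  refine ⟨⟨(u, v), huv⟩, fun x => ?_⟩
  rcases x with u' | v'
  · simp only [edgeFamily]
    split_ifs with heq
    · rw [heq, hu]
    · have := hl u' u heq
      rwa [hu, mul_one] at this
  · simp only [edgeFamily]
    split_ifs with heq
    · rw [heq, hv]
    · have := hr v' v heq
      rwa [hv, mul_one] at this

/-- All generators act as scalars, so the span of any unit vector is invariant and by irreducibility
is the whole space. -/
theorem IrrRep.equivalent_edgeRep_of_commute (π : IrrRep (CStarGraph G))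
    (h : ∀ u v, Commute (π.toHom (p G (Sum.inl u))) (π.toHom (p G (Sum.inr v)))) :
    ∃ e : G.edges, (edgeRep e).Equivalent π := by
  classical
  obtain ⟨e, he⟩ := π.exists_edge_of_commute h
  obtain ⟨x, hx⟩ := exists_norm_eq π.H (zero_le_one (α := ℝ))
  have hT := lineIsometry_edgeRep π.toHom e x hx fun y => by
    rw [he, edgeFamily_eq, edgeFamily_eq]
    split_ifs
    · rw [one_smul]; rfl
    · rw [zero_smul]; rfl
  let T : (edgeRep e).H →ₗᵢ[ℂ] π.H := lineIsometry x hx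
  have hsurj : Function.Surjective T := by
    rw [← LinearIsometry.coe_toLinearMap, ← LinearMap.range_eq_top]
    refine (π.irreducible (LinearMap.range T.toLinearMap) ?_ ?_).resolve_left fun hbot => ?_
    · have : FiniteDimensional ℂ (edgeRep e).H :=
        inferInstanceAs (FiniteDimensional ℂ (EuclideanSpace ℂ (ULift.{max u v} (Fin 1))))
      exact Submodule.closed_of_finiteDimensional _
    · rintro a _ ⟨y, rfl⟩
      exact ⟨_, hT a y⟩
    · have hmem : x ∈ LinearMap.range T.toLinearMap :=
        ⟨EuclideanSpace.single ⟨0⟩ 1, by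
          change lineIsometry x hx (EuclideanSpace.single ⟨0⟩ 1) = x
          simp [lineIsometry_apply]⟩
      rw [hbot, Submodule.mem_bot] at hmem
      rw [hmem, norm_zero] at hx
      exact zero_ne_one hx
  exact ⟨e, LinearIsometryEquiv.ofSurjective T hsurj, hT⟩

theorem IrrRep.equivalent_edgeRep_of_finrank_one (π : IrrRep (CStarGraph G))
    (hd : Module.finrank ℂ π.H = 1) : ∃ e : G.edges, (edgeRep e).Equivalent π := by
  refine π.equivalent_edgeRep_of_commute fun u v => ?_
  obtain ⟨x, hx0, hx⟩ := finrank_eq_one_iff'.1 hd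
  refine ContinuousLinearMap.ext fun y => ?_
  change π.toHom (p G (Sum.inl u)) (π.toHom (p G (Sum.inr v)) y) =
    π.toHom (p G (Sum.inr v)) (π.toHom (p G (Sum.inl u)) y)
  obtain ⟨c, rfl⟩ := hx y
  obtain ⟨a, ha⟩ := hx (π.toHom (p G (Sum.inl u)) x)
  obtain ⟨b, hb⟩ := hx (π.toHom (p G (Sum.inr v)) x)
  simp only [map_smul, ← ha, ← hb, smul_comm a b]

/-! ### Two-dimensional representations with noncommuting generators -/

/-- Two vertices on either side, all joined by edges, span a `K_{2,2}`. -/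
theorem exists_K22Subgraph {u u' : U} {v v' : V} (hu : u ≠ u') (hv : v ≠ v')
    (h : ∀ a ∈ ({u, u'} : Set U), ∀ b ∈ ({v, v'} : Set V), (a, b) ∈ G.edges) :
    ∃ H : K22Subgraph G, H.1.left = {u, u'} ∧ H.1.right = {v, v'} := by
  let f : Fin 2 ≃ ({u, u'} : Set U) :=
    (Finite.equivFinOfCardEq (by rw [Nat.card_coe_set_eq, Set.ncard_pair hu])).symm
  let g : Fin 2 ≃ ({v, v'} : Set V) :=
    (Finite.equivFinOfCardEq (by rw [Nat.card_coe_set_eq, Set.ncard_pair hv])).symm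
  exact ⟨⟨⟨{u, u'}, {v, v'}, {u, u'} ×ˢ {v, v'}, fun e he => h _ he.1 _ he.2, fun e he => he.1,
    fun e he => he.2⟩, ⟨⟨f, g, fun i j => ⟨fun _ => ⟨(f i).2, (g j).2⟩, fun _ => trivial⟩⟩⟩⟩,
    rfl, rfl⟩

/-- Noncommuting projections are neither 0 nor 1, so in the plane each side reduces to a
complementary pair. The conclusion is stated for every labelling because the labellings in the
theorem are given beforehand. -/
theorem IrrRep.exists_square_of_not_commute (π : IrrRep (CStarGraph G))
    (hd : Module.finrank ℂ π.H = 2) {u : U} {v : V}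
    (h : ¬ Commute (π.toHom (p G (Sum.inl u))) (π.toHom (p G (Sum.inr v)))) :
    ∃ H : K22Subgraph G, ∀ l : H.Labelling,
      π.toHom (p G (Sum.inl (l.left 0))) + π.toHom (p G (Sum.inl (l.left 1))) = 1 ∧
      π.toHom (p G (Sum.inr (l.right 0))) + π.toHom (p G (Sum.inr (l.right 1))) = 1 ∧
      ¬ Commute (π.toHom (p G (Sum.inl (l.left 0)))) (π.toHom (p G (Sum.inr (l.right 0)))) ∧
      (∀ u ∉ H.1.left, π.toHom (p G (Sum.inl u)) = 0) ∧
      ∀ v ∉ H.1.right, π.toHom (p G (Sum.inr v)) = 0 := by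
  have hF := (isProjectionFamily_p G).map π.toHom
  obtain ⟨u', hu, hsu, hu0⟩ := IsStarProjection.exists_pair_of_finrank_two
    (F := fun u => π.toHom (p G (Sum.inl u))) hd (fun u => hF.isStarProjection _) hF.sum_left
    (i := u) (fun h0 => h (by rw [h0]; exact Commute.zero_left _))
    (fun h1 => h (by rw [h1]; exact Commute.one_left _))
  obtain ⟨v', hv, hsv, hv0⟩ := IsStarProjection.exists_pair_of_finrank_two
    (F := fun v => π.toHom (p G (Sum.inr v))) hd (fun v => hF.isStarProjection _) hF.sum_right
    (i := v) (fun h0 => h (by rw [h0]; exact Commute.zero_right _))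
    (fun h1 => h (by rw [h1]; exact Commute.one_right _))
  have hl : ∀ b, Commute (π.toHom (p G (Sum.inl u'))) b → Commute (π.toHom (p G (Sum.inl u))) b :=
    fun b hb => by
      rw [eq_sub_of_add_eq hsu]
      exact (Commute.one_left b).sub_left hb
  have hr : ∀ b, Commute b (π.toHom (p G (Sum.inr v'))) → Commute b (π.toHom (p G (Sum.inr v))) :=
    fun b hb => by
      rw [eq_sub_of_add_eq hsv]
      exact (Commute.one_right b).sub_right hb
  -- Replacing a projection by its complement does not affect commutation, so all four pairs fail to
  -- commute. A non-edge would give p_a p_b = 0 and hence p_b p_a = 0.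
  have hnc : ∀ a ∈ ({u, u'} : Set U), ∀ b ∈ ({v, v'} : Set V),
      ¬ Commute (π.toHom (p G (Sum.inl a))) (π.toHom (p G (Sum.inr b))) := by
    rintro a (rfl | rfl) b (rfl | rfl) hc
    exacts [h hc, h (hr _ hc), h (hl _ hc), h (hl _ (hr _ hc))]
  have hedge : ∀ a ∈ ({u, u'} : Set U), ∀ b ∈ ({v, v'} : Set V), (a, b) ∈ G.edges := by
    intro a ha b hb
    by_contra hne
    refine hnc a ha b hb ?_
    have h0 := hF.mul_eq_zero a b hne
    exact h0.trans (((hF.isStarProjection _).mul_eq_zero_comm (hF.isStarProjection _)).1 h0).symm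
  obtain ⟨H, hHl, hHr⟩ := exists_K22Subgraph hu hv hedge
  refine ⟨H, fun l => ?_⟩
  have hl0 : (l.left 0 : U) ∈ ({u, u'} : Set U) := hHl ▸ (l.left 0).2
  have hl1 : (l.left 1 : U) ∈ ({u, u'} : Set U) := hHl ▸ (l.left 1).2
  have hr0 : (l.right 0 : V) ∈ ({v, v'} : Set V) := hHr ▸ (l.right 0).2
  have hr1 : (l.right 1 : V) ∈ ({v, v'} : Set V) := hHr ▸ (l.right 1).2
  have hlne : (l.left 0 : U) ≠ l.left 1 := fun h => zero_ne_one ((left_inj l).1 h)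
  have hrne : (l.right 0 : V) ≠ l.right 1 := fun h => zero_ne_one ((right_inj l).1 h)
  refine ⟨?_, ?_, hnc _ hl0 _ hr0, fun a ha => ?_, fun b hb => ?_⟩
  · rcases hl0 with h0 | h0 <;> rcases hl1 with h1 | h1
    · exact absurd (h0.trans h1.symm) hlne
    · rw [h0, h1]; exact hsu
    · rw [h0, h1, add_comm]; exact hsu
    · exact absurd (h0.trans h1.symm) hlne
  · rcases hr0 with h0 | h0 <;> rcases hr1 with h1 | h1
    · exact absurd (h0.trans h1.symm) hrne
    · rw [h0, h1]; exact hsv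
    · rw [h0, h1, add_comm]; exact hsv
    · exact absurd (h0.trans h1.symm) hrne
  · rw [hHl, Set.mem_insert_iff, Set.mem_singleton_iff, not_or] at ha
    exact hu0 a ha.1 ha.2
  · rw [hHr, Set.mem_insert_iff, Set.mem_singleton_iff, not_or] at hb
    exact hv0 b hb.1 hb.2

/-- The isometry of the plane onto a two-dimensional Hilbert space given by an orthonormal pair. -/
theorem exists_planeIsometry {K : Type z} [NormedAddCommGroup K] [InnerProductSpace ℂ K]
    (hd : Module.finrank ℂ K = 2) {e f : K} (hef : Orthonormal ℂ ![e, f]) :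
    ∃ T : EuclideanSpace ℂ (ULift.{w} (Fin 2)) ≃ₗᵢ[ℂ] K, ∀ y, T y = y ⟨0⟩ • e + y ⟨1⟩ • f := by
  have hon : Orthonormal ℂ fun i : ULift.{w} (Fin 2) => ![e, f] i.down :=
    hef.comp _ ULift.down_injective
  let b : OrthonormalBasis (ULift.{w} (Fin 2)) ℂ K :=
    (basisOfOrthonormalOfCardEqFinrank hon (by simp [hd])).toOrthonormalBasis (by simpa using hon)
  have hb : ∀ i, b i = ![e, f] i.down := fun i => by simp [b]
  refine ⟨b.repr.symm, fun y => ?_⟩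
  rw [← b.sum_repr_symm, ← Equiv.ulift.symm.sum_comp, Fin.sum_univ_two, hb, hb]
  rfl

/-- The normal form of one projection from each side determines everything: the other two of the
square are complements, and the remaining generators vanish. -/
theorem exists_squareHom_intertwines {K : Type z} [NormedAddCommGroup K] [InnerProductSpace ℂ K]
    [CompleteSpace K] (π : CStarGraph G →⋆ₐ[ℂ] (K →L[ℂ] K)) (hd : Module.finrank ℂ K = 2)
    {H : K22Subgraph G} (l : H.Labelling) (t : Set.Icc (0 : ℝ) 1) {e f : K}
    (hef : Orthonormal ℂ ![e, f])
    (hl : π (p G (Sum.inl (l.left 0))) + π (p G (Sum.inl (l.left 1))) = 1)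
    (hr : π (p G (Sum.inr (l.right 0))) + π (p G (Sum.inr (l.right 1))) = 1)
    (hl0 : ∀ u ∉ H.1.left, π (p G (Sum.inl u)) = 0)
    (hr0 : ∀ v ∉ H.1.right, π (p G (Sum.inr v)) = 0)
    (hPe : π (p G (Sum.inl (l.left 0))) e = e) (hPf : π (p G (Sum.inl (l.left 0))) f = 0)
    (hQe : π (p G (Sum.inr (l.right 0))) e =
      ((1 - t : ℝ) : ℂ) • e + ((√(t * (1 - t)) : ℝ) : ℂ) • f)
    (hQf : π (p G (Sum.inr (l.right 0))) f =
      ((√(t * (1 - t)) : ℝ) : ℂ) • e + ((t : ℝ) : ℂ) • f) :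
    ∃ T : EuclideanSpace ℂ (ULift.{max u v} (Fin 2)) ≃ₗᵢ[ℂ] K,
      ∀ a y, T (squareHom l t a y) = π a (T y) := by
  obtain ⟨T, hT⟩ := exists_planeIsometry.{max u v} hd hef
  refine ⟨T, fun a y => congrArg (fun f => f y)
    (intertwines (squareHom l t) π T.toContinuousLinearEquiv (fun x => ?_) a)⟩
  refine ContinuousLinearMap.ext fun y => ?_
  change T (squareHom l t (p G x) y) = π (p G x) (T y)
  rw [squareHom_p, hT, hT, matrixAction_apply, matrixAction_apply]
  have h1l := eq_sub_of_add_eq' hl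
  have h1r := eq_sub_of_add_eq' hr
  rcases x with a | a
  · by_cases ha : a ∈ H.1.left
    · obtain ⟨i, rfl⟩ := (mem_left_iff l _).1 ha
      rw [squareFamily_left]
      fin_cases i
      · simp [leftMatrix, hPe, hPf]
      · simp [leftMatrix, h1l, hPe, hPf]
    · rw [squareFamily_of_notMem_left l _ ha, hl0 a ha]
      simp
  · by_cases ha : a ∈ H.1.right
    · obtain ⟨i, rfl⟩ := (mem_right_iff l _).1 ha
      rw [squareFamily_right]
      fin_cases i
      · simp only [rightMatrix, Fin.zero_eta, map_add, map_smul, hQe, hQf]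
        simp
        module
      · simp only [rightMatrix, Fin.mk_one, h1r, _root_.sub_apply,
          one_apply_eq_self, map_add, map_smul, hQe, hQf]
        simp
        module
    · rw [squareFamily_of_notMem_right l _ ha, hr0 a ha]
      simp

theorem IrrRep.equivalent_squareRep_of_not_commute (π : IrrRep (CStarGraph G))
    (hd : Module.finrank ℂ π.H = 2) {u : U} {v : V}
    (h : ¬ Commute (π.toHom (p G (Sum.inl u))) (π.toHom (p G (Sum.inr v)))) :
    ∃ H : K22Subgraph G, ∀ l : H.Labelling, ∃ t, (squareRep l t).Equivalent π := by
  obtain ⟨H, hH⟩ := π.exists_square_of_not_commute hd h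
  refine ⟨H, fun l => ?_⟩
  obtain ⟨hl, hr, hnc, hl0, hr0⟩ := hH l
  obtain ⟨t, e, f, hef, hPe, hPf, hQe, hQf⟩ := IsStarProjection.exists_orthonormal_pair hd
    (π.isStarProjection_p _) (π.isStarProjection_p _) hnc
  obtain ⟨T, hT⟩ := exists_squareHom_intertwines π.toHom hd l
    ⟨t, Set.Ioo_subset_Icc_self t.2⟩ hef hl hr hl0 hr0 hPe hPf hQe hQf
  exact ⟨t, T, hT⟩

end Classification

/-! ### The topology of the spectrum in dimension at most two -/

namespace SpecLeTwo

open CStarGraph K22Subgraph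

variable {U : Type u} {V : Type v} [Fintype U] [Fintype V] {G : BipartiteGraph U V}

/-- The points at which `a` does not vanish. -/
def support (a : CStarGraph G) : Set (SpecLeTwo (CStarGraph G)) :=
  Subtype.val ⁻¹' Spec.nonvanishing a

/-- The points at which the norm of `p_u p_v p_u` exceeds `r`. -/
def cornerGt (e : U × V) (r : ℝ) : Set (SpecLeTwo (CStarGraph G)) :=
  Subtype.val ⁻¹' Spec.normGt (corner e) r

theorem isOpen_support (a : CStarGraph G) : IsOpen (support a) :=
  (Spec.isOpen_nonvanishing a).preimage continuous_subtype_val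

theorem isOpen_cornerGt (e : U × V) (r : ℝ) : IsOpen (cornerGt (G := G) e r) :=
  (Spec.isOpen_normGt _ r).preimage continuous_subtype_val

theorem exists_support_subset {s : Set (SpecLeTwo (CStarGraph G))} (hs : IsOpen s)
    {x : SpecLeTwo (CStarGraph G)} (hx : x ∈ s) : ∃ a, x ∈ support a ∧ support a ⊆ s := by
  obtain ⟨T, hT, rfl⟩ := isOpen_induced_iff.1 hs
  obtain ⟨a, ha, haT⟩ := Spec.exists_nonvanishing_subset hT hx
  exact ⟨a, ha, Set.preimage_mono haT⟩

theorem continuous_of_isOpen_preimage_support {X : Type z} [TopologicalSpace X]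
    {f : X → SpecLeTwo (CStarGraph G)} (h : ∀ a, IsOpen (f ⁻¹' support a)) : Continuous f := by
  refine continuous_def.2 fun s hs => isOpen_iff_forall_mem_open.2 fun x hx => ?_
  obtain ⟨a, ha, hs⟩ := exists_support_subset hs hx
  exact ⟨_, Set.preimage_mono hs, h a, ha⟩

theorem piPt_mem_support {e : G.edges} {a : CStarGraph G} :
    piPt e ∈ support a ↔ (edgeRep e).toHom a ≠ 0 := Iff.rfl

open Classical in
theorem piPt_mem_support_p {e : G.edges} {x : U ⊕ V} :
    piPt e ∈ support (p G x) ↔ IsEndpoint e.1 x := by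
  rw [piPt_mem_support, edgeRep_p]
  split_ifs with h <;> simp [h]

open Classical in
theorem piPt_mem_cornerGt {e : G.edges} {f : U × V} {r : ℝ} (hr : 0 ≤ r) :
    piPt e ∈ cornerGt f r ↔ r < if f = e.1 then 1 else 0 := by
  refine (Spec.mk_mem_normGt (isSelfAdjoint_corner f) hr).trans ?_
  rw [edgeRep_corner]
  split_ifs
  · rw [norm_one]
  · rw [norm_zero]

variable {H H' : K22Subgraph G} (l : H.Labelling) (l' : H'.Labelling)

theorem sigmaPt_mem_support {t : Set.Ioo (0 : ℝ) 1} {a : CStarGraph G} :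
    sigmaPt l t ∈ support a ↔ squareHom l ⟨t, Set.Ioo_subset_Icc_self t.2⟩ a ≠ 0 := Iff.rfl

theorem sigmaPt_mem_support_left (t : Set.Ioo (0 : ℝ) 1) (i : Fin 2) :
    sigmaPt l t ∈ support (p G (Sum.inl (l.left i))) := by
  rw [sigmaPt_mem_support, squareHom_p, squareFamily_left]
  exact matrixAction_ne_zero (leftMatrix_ne_zero i)

theorem sigmaPt_mem_cornerGt {t : Set.Ioo (0 : ℝ) 1} {i j : Fin 2} {r : ℝ} (hr : 0 ≤ r) :
    sigmaPt l t ∈ cornerGt ((l.left i : U), (l.right j : V)) r ↔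
      r < if i = j then 1 - (t : ℝ) else t := by
  refine (Spec.mk_mem_normGt (isSelfAdjoint_corner _) hr).trans ?_
  rw [← norm_squareHom_corner l ⟨t, Set.Ioo_subset_Icc_self t.2⟩ i j]
  rfl

theorem mem_edges_of_sigmaPt_mem_cornerGt {t : Set.Ioo (0 : ℝ) 1} {e : U × V} {r : ℝ} (hr : 0 ≤ r)
    (h : sigmaPt l t ∈ cornerGt e r) : e ∈ H.1.edges := by
  by_contra he
  have h1 : r < ‖squareHom l ⟨t, Set.Ioo_subset_Icc_self t.2⟩ (corner e)‖ :=
    (Spec.mk_mem_normGt (isSelfAdjoint_corner e) hr).1 h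
  rw [squareHom_corner_of_notMem l _ he, norm_zero] at h1
  linarith

theorem exists_piPt_or_sigmaPt (l : ∀ H : K22Subgraph G, H.Labelling)
    (x : SpecLeTwo (CStarGraph G)) : (∃ e, x = piPt e) ∨ ∃ H t, x = sigmaPt (l H) t := by
  obtain ⟨_, π, rfl, hd⟩ := x
  have hedge : (∃ e : G.edges, (edgeRep e).Equivalent π) →
      ∃ e, (⟨Spec.mk π, π, rfl, hd⟩ : SpecLeTwo (CStarGraph G)) = piPt e := by
    rintro ⟨e, he⟩
    exact ⟨e, Subtype.ext (Quotient.sound he).symm⟩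
  rcases hd with hd | hd
  · exact Or.inl (hedge (π.equivalent_edgeRep_of_finrank_one hd))
  -- Commuting generators cannot occur in dimension two, but this need not be excluded: the
  -- representation would be equivalent to an edge representation, which suffices here.
  · by_cases h : ∀ u v, Commute (π.toHom (p G (Sum.inl u))) (π.toHom (p G (Sum.inr v)))
    · exact Or.inl (hedge (π.equivalent_edgeRep_of_commute h))
    · push Not at h
      obtain ⟨u, v, h⟩ := h
      obtain ⟨H, hH⟩ := π.equivalent_squareRep_of_not_commute hd h
      obtain ⟨t, ht⟩ := hH (l H)
      exact Or.inr ⟨H, t, Subtype.ext (Quotient.sound ht).symm⟩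

/-! #### The open sets `{σ_{H,t}}` -/

/-- The element `p_{u₁} p_{v₁} p_{u₂} p_{v₂}`. -/
def squareWord : CStarGraph G :=
  p G (Sum.inl (l.left 0)) * p G (Sum.inr (l.right 0)) * p G (Sum.inl (l.left 1)) *
    p G (Sum.inr (l.right 1))

theorem sigmaPt_mem_support_squareWord (t : Set.Ioo (0 : ℝ) 1) :
    sigmaPt l t ∈ support (squareWord l) := by
  rw [sigmaPt_mem_support, squareWord]
  simp only [map_mul, squareHom_p, squareFamily_left, squareFamily_right]
  rw [← map_mul, ← map_mul, ← map_mul]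
  refine matrixAction_ne_zero fun h => ?_
  have h0 := congrFun (congrFun h 0) 0
  have ht : √((t : ℝ) * (1 - t)) ≠ 0 :=
    (Real.sqrt_pos.2 (mul_pos t.2.1 (sub_pos.2 t.2.2))).ne'
  simp [leftMatrix, rightMatrix, Matrix.mul_apply, Fin.sum_univ_two] at h0
  exact ht h0

theorem piPt_notMem_support_squareWord (e : G.edges) : piPt e ∉ support (squareWord l) := by
  classical
  rw [piPt_mem_support, not_not, squareWord]
  have hz : ∀ x, ¬ IsEndpoint e.1 x → (edgeRep e).toHom (p G x) = 0 := fun x hx => by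
    rw [edgeRep_p, if_neg hx]
  simp only [map_mul]
  by_cases h0 : (l.left 0 : U) = e.1.1
  · have h1 : (l.left 1 : U) ≠ e.1.1 := fun h1 =>
      zero_ne_one ((left_inj l).1 (h0.trans h1.symm))
    rw [hz (Sum.inl (l.left 1)) h1, mul_zero, zero_mul]
  · rw [hz (Sum.inl (l.left 0)) h0, zero_mul, zero_mul, zero_mul]

theorem eq_of_sigmaPt_mem_support_squareWord {t : Set.Ioo (0 : ℝ) 1}
    (h : sigmaPt l' t ∈ support (squareWord l)) : H = H' := by
  rw [sigmaPt_mem_support, squareWord] at h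
  simp only [map_mul, squareHom_p] at h
  refine eq_of_subset (fun u hu => ?_) fun v hv => ?_
  · obtain ⟨i, rfl⟩ := (mem_left_iff l u).1 hu
    by_contra hne
    have h0 := squareFamily_of_notMem_left l' t hne
    refine h ?_
    obtain rfl | rfl : i = 0 ∨ i = 1 := by omega
    · rw [h0, map_zero matrixAction, zero_mul, zero_mul, zero_mul]
    · rw [h0, map_zero matrixAction, mul_zero, zero_mul]
  · obtain ⟨i, rfl⟩ := (mem_right_iff l v).1 hv
    by_contra hne
    have h0 := squareFamily_of_notMem_right l' t hne
    refine h ?_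
    obtain rfl | rfl : i = 0 ∨ i = 1 := by omega
    · rw [h0, map_zero matrixAction, mul_zero, zero_mul, zero_mul]
    · rw [h0, map_zero matrixAction, mul_zero]

/-- The word contains two different left vertices, so every π_e kills it; it contains all four
vertices of H, so every σ_{H',t} with H' ≠ H kills it. At σ_{H,t} its upper left entry is -t(1 - t).
-/
theorem sigmaSet_eq (l : ∀ H : K22Subgraph G, H.Labelling) (H : K22Subgraph G) :
    sigmaSet (l H) = support (squareWord (l H)) := by
  ext x
  refine ⟨?_, fun hx => ?_⟩
  · rintro ⟨t, rfl⟩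
    exact sigmaPt_mem_support_squareWord (l H) t
  · rcases exists_piPt_or_sigmaPt l x with ⟨e, rfl⟩ | ⟨H', t, rfl⟩
    · exact absurd hx (piPt_notMem_support_squareWord _ e)
    · obtain rfl := eq_of_sigmaPt_mem_support_squareWord _ _ hx
      exact ⟨t, rfl⟩

theorem isOpen_sigmaSet (l : ∀ H : K22Subgraph G, H.Labelling) (H : K22Subgraph G) :
    IsOpen (sigmaSet (l H)) := by
  rw [sigmaSet_eq]
  exact isOpen_support _

/-! #### The paths through the points `σ_{H,t}` -/

/-- The path `t ↦ σ_{H,t}`, extended to `[0,1]` by the edges that contain `u_i`. -/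
def path (i : Fin 2) (t : Set.Icc (0 : ℝ) 1) : SpecLeTwo (CStarGraph G) :=
  if h0 : (t : ℝ) = 0 then piPt ⟨_, H.1.edges_subset (edge_mem l i i)⟩
  else if h1 : (t : ℝ) = 1 then piPt ⟨_, H.1.edges_subset (edge_mem l i (i + 1))⟩
  else sigmaPt l ⟨t, lt_of_le_of_ne t.2.1 (Ne.symm h0), lt_of_le_of_ne t.2.2 h1⟩

theorem path_zero (i : Fin 2) {t : Set.Icc (0 : ℝ) 1} (ht : (t : ℝ) = 0) :
    path l i t = piPt ⟨_, H.1.edges_subset (edge_mem l i i)⟩ := dif_pos ht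

theorem path_one (i : Fin 2) {t : Set.Icc (0 : ℝ) 1} (ht : (t : ℝ) = 1) :
    path l i t = piPt ⟨_, H.1.edges_subset (edge_mem l i (i + 1))⟩ := by
  rw [path, dif_neg (by rw [ht]; exact one_ne_zero), dif_pos ht]

theorem path_of_mem_Ioo (i : Fin 2) {t : Set.Icc (0 : ℝ) 1} (ht : (t : ℝ) ∈ Set.Ioo (0 : ℝ) 1) :
    path l i t = sigmaPt l ⟨t, ht⟩ := by
  rw [path, dif_neg ht.1.ne', dif_neg ht.2.ne]

theorem mem_Ioo_or (t : Set.Icc (0 : ℝ) 1) :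
    (t : ℝ) = 0 ∨ (t : ℝ) = 1 ∨ (t : ℝ) ∈ Set.Ioo (0 : ℝ) 1 := by
  rcases t.2.1.eq_or_lt with h | h
  · exact Or.inl h.symm
  rcases t.2.2.eq_or_lt with h' | h'
  · exact Or.inr (Or.inl h')
  · exact Or.inr (Or.inr ⟨h, h'⟩)

/-- The hypothesis `hm` says that the i-th basis vector is fixed by the m-th right projection and
killed by the other. This happens for m = i at t = 0 and for m = i + 1, the other index, at t = 1.
The vector then spans a copy of π_e, with e = {u_i, v_m}, inside the square representation. -/
theorem squareHom_ne_zero_of_edgeRep_ne_zero {t : Set.Icc (0 : ℝ) 1} {i m : Fin 2}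
    (hm : ∀ j k, rightMatrix t j k i = if k = i ∧ j = m then 1 else 0) {a : CStarGraph G}
    (ha : (edgeRep ⟨_, H.1.edges_subset (edge_mem l i m)⟩).toHom a ≠ 0) :
    squareHom l t a ≠ 0 := by
  classical
  contrapose! ha
  let x : EuclideanSpace ℂ (ULift.{max u v} (Fin 2)) := EuclideanSpace.single ⟨i⟩ 1
  have hx : ‖x‖ = 1 := by simp [x]
  have hl : ∀ k, matrixAction (leftMatrix k) x = (if k = i then (1 : ℂ) else 0) • x := fun k => by
    refine PiLp.ext fun j => ?_
    obtain ⟨j⟩ := j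
    rw [matrixAction_apply]
    fin_cases i <;> fin_cases k <;> fin_cases j <;> simp [leftMatrix, x]
  have hr : ∀ j, matrixAction (rightMatrix t j) x = (if j = m then (1 : ℂ) else 0) • x :=
    fun j => by
      refine PiLp.ext fun k => ?_
      obtain ⟨k⟩ := k
      have h := hm j k
      rw [matrixAction_apply]
      by_cases hj : j = m <;> fin_cases i <;> fin_cases k <;> simp_all [x]
  have h := lineIsometry_edgeRep (squareHom l t) ⟨_, H.1.edges_subset (edge_mem l i m)⟩ x hx
    (fun y => by
      rw [squareHom_p, edgeFamily_eq]
      rcases y with b | b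
      · by_cases hb : b ∈ H.1.left
        · obtain ⟨k, rfl⟩ := (mem_left_iff l b).1 hb
          rw [squareFamily_left, hl]
          simp only [IsEndpoint, left_inj]
        · rw [squareFamily_of_notMem_left l t hb, if_neg, zero_smul, map_zero]
          · rfl
          · rintro rfl
            exact hb (l.left i).2
      · by_cases hb : b ∈ H.1.right
        · obtain ⟨k, rfl⟩ := (mem_right_iff l b).1 hb
          rw [squareFamily_right, hr]
          simp only [IsEndpoint, right_inj]
        · rw [squareFamily_of_notMem_right l t hb, if_neg, zero_smul, map_zero]
          · rfl
          · rintro rfl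
            exact hb (l.right m).2)
  refine ContinuousLinearMap.ext fun y => ?_
  have hy := h a y
  rw [ha] at hy
  exact (map_eq_zero_iff _ (lineIsometry x hx).injective).1 hy

theorem squareHom_ne_zero_of_path_mem_support {i : Fin 2} {t : Set.Icc (0 : ℝ) 1}
    {a : CStarGraph G} (h : path l i t ∈ support a) : squareHom l t a ≠ 0 := by
  rcases mem_Ioo_or t with ht | ht | ht
  · rw [path_zero l i ht] at h
    refine squareHom_ne_zero_of_edgeRep_ne_zero l (fun j k => ?_) h
    rw [ht]
    fin_cases i <;> fin_cases j <;> fin_cases k <;> simp [rightMatrix]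
  · rw [path_one l i ht] at h
    refine squareHom_ne_zero_of_edgeRep_ne_zero l (fun j k => ?_) h
    rw [ht]
    fin_cases i <;> fin_cases j <;> fin_cases k <;> simp [rightMatrix]
  · rw [path_of_mem_Ioo l i ht] at h
    exact h

/-- At an end point the path follows only one of the two characters into which the square
representation splits. So the set where `a` survives along the path lies in the open set where the
square representation of `a` is nonzero, and differs from it at most by end points, a finite and
hence closed set. -/
theorem continuous_path (i : Fin 2) : Continuous (path l i) := by
  refine continuous_of_isOpen_preimage_support fun a => ?_
  have h : path l i ⁻¹' support a = {t | squareHom l t a ≠ 0} \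
      ({t | (t : ℝ) ∈ ({0, 1} : Set ℝ)} \ path l i ⁻¹' support a) := by
    ext t
    refine ⟨fun ht => ⟨squareHom_ne_zero_of_path_mem_support l ht, fun h => h.2 ht⟩, ?_⟩
    rintro ⟨h1, h2⟩
    by_contra hn
    refine h2 ⟨?_, hn⟩
    rcases mem_Ioo_or t with ht | ht | ht
    · exact Or.inl ht
    · exact Or.inr ht
    · exact absurd (show path l i t ∈ support a by rw [path_of_mem_Ioo l i ht]; exact h1) hn
  rw [h]
  refine (isOpen_ne_fun (continuous_squareHom l a) continuous_const).sdiff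
    (Set.Finite.isClosed (Set.Finite.subset ?_ Set.sdiff_subset))
  exact (Set.toFinite ({0, 1} : Set ℝ)).preimage Subtype.val_injective.injOn

theorem path_mem_cornerGt_self {i : Fin 2} {t : Set.Icc (0 : ℝ) 1} {r : ℝ} (hr : 0 ≤ r) :
    path l i t ∈ cornerGt ((l.left i : U), (l.right i : V)) r ↔ r < 1 - (t : ℝ) := by
  rcases mem_Ioo_or t with ht | ht | ht
  · rw [path_zero l i ht, piPt_mem_cornerGt hr, if_pos rfl, ht, sub_zero]
  · rw [path_one l i ht, piPt_mem_cornerGt hr, if_neg, ht, sub_self]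
    rw [Prod.ext_iff, right_inj]
    simp
  · rw [path_of_mem_Ioo l i ht, sigmaPt_mem_cornerGt l hr, if_pos rfl]

theorem path_mem_cornerGt_succ {i : Fin 2} {t : Set.Icc (0 : ℝ) 1} {r : ℝ} (hr : 0 ≤ r) :
    path l i t ∈ cornerGt ((l.left i : U), (l.right (i + 1) : V)) r ↔ r < (t : ℝ) := by
  rcases mem_Ioo_or t with ht | ht | ht
  · rw [path_zero l i ht, piPt_mem_cornerGt hr, if_neg, ht]
    rw [Prod.ext_iff, right_inj]
    simp
  · rw [path_one l i ht, piPt_mem_cornerGt hr, if_pos rfl, ht]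
  · rw [path_of_mem_Ioo l i ht, sigmaPt_mem_cornerGt l hr, if_neg (by simp)]

/-- The two corners at u_i have norms t and 1 - t along the whole path, end points included. Their
superlevel sets pull back to the open rays {t > a} and {t < a}, which generate the topology of
[0,1]. -/
theorem isInducing_path (i : Fin 2) : IsInducing (path l i) := by
  refine ⟨le_antisymm (continuous_path l i).le_induced ?_⟩
  rw [OrderTopology.topology_eq_generate_intervals (α := Set.Icc (0 : ℝ) 1)]
  refine le_generateFrom ?_
  rintro _ ⟨a, rfl | rfl⟩
  · refine isOpen_induced_iff.2 ⟨_, isOpen_cornerGt ((l.left i : U), (l.right (i + 1) : V)) a, ?_⟩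
    ext t
    exact path_mem_cornerGt_succ l a.2.1
  · refine isOpen_induced_iff.2 ⟨_, isOpen_cornerGt ((l.left i : U), (l.right i : V)) (1 - a), ?_⟩
    ext t
    refine (path_mem_cornerGt_self l (sub_nonneg.2 a.2.2)).trans ?_
    rw [sub_lt_sub_iff_left]
    rfl

theorem path_mem_support (i : Fin 2) (t : Set.Icc (0 : ℝ) 1) :
    path l i t ∈ support (p G (Sum.inl (l.left i))) := by
  rcases mem_Ioo_or t with ht | ht | ht
  · rw [path_zero l i ht, piPt_mem_support_p]
    rfl
  · rw [path_one l i ht, piPt_mem_support_p]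
    rfl
  · rw [path_of_mem_Ioo l i ht]
    exact sigmaPt_mem_support_left l _ i

theorem path_mem_XSet (i : Fin 2) (t : Set.Icc (0 : ℝ) 1) : path l i t ∈ XSet l := by
  rcases mem_Ioo_or t with ht | ht | ht
  · rw [path_zero l i ht]
    exact Or.inl ⟨_, edge_mem l i i, rfl⟩
  · rw [path_one l i ht]
    exact Or.inl ⟨_, edge_mem l i (i + 1), rfl⟩
  · rw [path_of_mem_Ioo l i ht]
    exact Or.inr ⟨_, rfl⟩

theorem sigmaPt_eq_path (i : Fin 2) (t : Set.Ioo (0 : ℝ) 1) :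
    sigmaPt l t = path l i ⟨t, Set.Ioo_subset_Icc_self t.2⟩ :=
  (path_of_mem_Ioo l i (t := ⟨t, Set.Ioo_subset_Icc_self t.2⟩) t.2).symm

/-- All σ_{H,t} see p_{u_i}, and among the edges of H exactly the two at u_i do. Hence each arc is
relatively open in X_H, which is what makes the gluing map open. -/
theorem range_path (i : Fin 2) :
    Set.range (path l i) = XSet l ∩ support (p G (Sum.inl (l.left i))) := by
  ext x
  refine ⟨?_, ?_⟩
  · rintro ⟨t, rfl⟩
    exact ⟨path_mem_XSet l i t, path_mem_support l i t⟩
  · rintro ⟨⟨⟨e, he'⟩, he, rfl⟩ | ⟨t, rfl⟩, hx⟩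
    · obtain ⟨k, j, rfl⟩ := (mem_edges_iff l e).1 he
      rw [piPt_mem_support_p] at hx
      obtain rfl := (left_inj l).1 hx
      have hj : j = i ∨ j = i + 1 := by omega
      rcases hj with rfl | rfl
      · exact ⟨⟨0, by simp⟩, path_zero l _ rfl⟩
      · exact ⟨⟨1, by simp⟩, path_one l _ rfl⟩
    · exact ⟨_, (sigmaPt_eq_path l i t).symm⟩

theorem injective_path (i : Fin 2) : Function.Injective (path l i) := (isInducing_path l i).injective

theorem isOpenEmbedding_sigmaPt (l : ∀ H : K22Subgraph G, H.Labelling) (H : K22Subgraph G) :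
    IsOpenEmbedding (sigmaPt (l H)) := by
  have h : sigmaPt (l H) = path (l H) 0 ∘ Set.inclusion Set.Ioo_subset_Icc_self :=
    funext fun t => sigmaPt_eq_path (l H) 0 t
  refine ⟨?_, isOpen_sigmaSet l H⟩
  rw [h]
  exact (IsEmbedding.mk (isInducing_path (l H) 0) (injective_path (l H) 0)).comp
    (IsEmbedding.inclusion Set.Ioo_subset_Icc_self)

/-! #### The space `X_H` -/

/-- The two paths as maps to `X_H`. -/
def pathX (i : Fin 2) : Set.Icc (0 : ℝ) 1 → XSet l := Set.codRestrict (path l i) _ (path_mem_XSet l i)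

theorem isOpenMap_pathX (i : Fin 2) : IsOpenMap (pathX l i) := by
  refine ((isInducing_path l i).codRestrict (path_mem_XSet l i)).isOpenMap ?_
  refine isOpen_induced_iff.2 ⟨_, isOpen_support (p G (Sum.inl (l.left i))), ?_⟩
  ext x
  have h : (x : SpecLeTwo (CStarGraph G)) ∈ Set.range (path l i) ↔
      (x : SpecLeTwo (CStarGraph G)) ∈ support (p G (Sum.inl (l.left i))) := by
    rw [range_path]
    exact and_iff_right x.2
  refine h.symm.trans (exists_congr fun t => ?_)
  exact (Subtype.ext_iff (a1 := pathX l i t) (a2 := x)).symm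

theorem continuous_pathX (i : Fin 2) : Continuous (pathX l i) :=
  (continuous_path l i).codRestrict _

/-- The parametrization of `X_H`. -/
def ofSpaceX : SpaceX → XSet l :=
  Quot.lift (Sum.elim (pathX l 0) (pathX l 1)) (by
    rintro _ _ ⟨t, h0, h1⟩
    refine Subtype.ext ?_
    change path l 0 t = path l 1 t
    rw [path_of_mem_Ioo l 0 ⟨h0, h1⟩, path_of_mem_Ioo l 1 ⟨h0, h1⟩])

theorem continuous_ofSpaceX : Continuous (ofSpaceX l) :=
  continuous_quot_lift _ ((continuous_pathX l 0).sumElim (continuous_pathX l 1))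

theorem isOpenMap_ofSpaceX : IsOpenMap (ofSpaceX l) := by
  intro W hW
  have h : ofSpaceX l '' W = Sum.elim (pathX l 0) (pathX l 1) '' (Quot.mk _ ⁻¹' W) := by
    rw [← Set.image_preimage_eq W Quot.mk_surjective, ← Set.image_comp,
      Set.image_preimage_eq W Quot.mk_surjective]
    rfl
  rw [h]
  exact (isOpenMap_sumElim.2 ⟨isOpenMap_pathX l 0, isOpenMap_pathX l 1⟩) _
    (hW.preimage continuous_quot_mk)

/-- The end points of the second path are edges at the other left vertex, invisible to the
projection that is nonzero along the first path. So t is interior, where the two paths agree, and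
injectivity of the first gives s = t. -/
theorem glueRel_of_path_eq {s t : Set.Icc (0 : ℝ) 1} (h : path l 0 s = path l 1 t) :
    GlueRel (Sum.inl s) (Sum.inr t) := by
  have hs := path_mem_support l 0 s
  rw [h] at hs
  have ht : (t : ℝ) ∈ Set.Ioo (0 : ℝ) 1 := by
    rcases mem_Ioo_or t with ht | ht | ht
    · rw [path_zero l 1 ht, piPt_mem_support_p] at hs
      exact absurd ((left_inj l).1 hs) zero_ne_one
    · rw [path_one l 1 ht, piPt_mem_support_p] at hs
      exact absurd ((left_inj l).1 hs) zero_ne_one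
    · exact ht
  have hst : s = t := injective_path l 0
    (h.trans ((path_of_mem_Ioo l 1 ht).trans (path_of_mem_Ioo l 0 ht).symm))
  rw [hst]
  exact GlueRel.glue t ht.1 ht.2

theorem bijective_ofSpaceX : Function.Bijective (ofSpaceX l) := by
  constructor
  · rintro ⟨s | s⟩ ⟨t | t⟩ h
    · exact congrArg _ (congrArg _ (injective_path l 0 (congrArg Subtype.val h)))
    · exact Quot.sound (glueRel_of_path_eq l (congrArg Subtype.val h))
    · exact (Quot.sound (glueRel_of_path_eq l (congrArg Subtype.val h).symm)).symm
    · exact congrArg _ (congrArg _ (injective_path l 1 (congrArg Subtype.val h)))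
  · have key : ∀ (i : Fin 2) x, x ∈ XSet l ∩ support (p G (Sum.inl (l.left i))) →
        ∃ t, path l i t = x := fun i x hx => by rwa [← range_path] at hx
    have hcover : ∀ x ∈ XSet l, ∃ i, x ∈ support (p G (Sum.inl (l.left i))) := by
      rintro _ (⟨⟨e, he'⟩, he, rfl⟩ | ⟨t, rfl⟩)
      · obtain ⟨i, j, rfl⟩ := (mem_edges_iff l e).1 he
        exact ⟨i, piPt_mem_support_p.2 rfl⟩
      · exact ⟨0, sigmaPt_mem_support_left l t 0⟩
    intro x
    obtain ⟨i, hi⟩ := hcover x x.2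
    obtain ⟨t, ht⟩ := key i x ⟨x.2, hi⟩
    fin_cases i
    · exact ⟨Quot.mk _ (Sum.inl t), Subtype.ext ht⟩
    · exact ⟨Quot.mk _ (Sum.inr t), Subtype.ext ht⟩

/-- `X_H` is the interval with doubled end points. -/
def homeomorphSpaceX : XSet l ≃ₜ SpaceX :=
  ((Equiv.ofBijective _ (bijective_ofSpaceX l)).toHomeomorphOfContinuousOpen
    (continuous_ofSpaceX l) (isOpenMap_ofSpaceX l)).symm

/-- A point lies outside X_H exactly when some generator p_x with x not a vertex of H is nonzero
there, so the complement is a union of open supports. -/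
theorem isClosed_XSet (l : ∀ H : K22Subgraph G, H.Labelling) (H : K22Subgraph G) :
    IsClosed (XSet (l H)) := by
  have h : (XSet (l H))ᶜ = (⋃ u ∈ H.1.leftᶜ, support (p G (Sum.inl u))) ∪
      ⋃ v ∈ H.1.rightᶜ, support (p G (Sum.inr v)) := by
    ext x
    simp only [Set.mem_union, Set.mem_iUnion, Set.mem_compl_iff, exists_prop]
    constructor
    · intro hx
      rcases exists_piPt_or_sigmaPt l x with ⟨e, rfl⟩ | ⟨H', t, rfl⟩
      · have he : e.1 ∉ H.1.edges := fun he => hx (Or.inl ⟨e, he, rfl⟩)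
        rw [mem_edges_iff_mem, not_and_or] at he
        rcases he with he | he
        · exact Or.inl ⟨_, he, piPt_mem_support_p.2 rfl⟩
        · exact Or.inr ⟨_, he, piPt_mem_support_p.2 rfl⟩
      · have hne : H' ≠ H := by
          rintro rfl
          exact hx (Or.inr ⟨t, rfl⟩)
        have hsub : ¬ (H'.1.left ⊆ H.1.left ∧ H'.1.right ⊆ H.1.right) := fun h =>
          hne (eq_of_subset h.1 h.2)
        rw [not_and_or, Set.not_subset, Set.not_subset] at hsub
        rcases hsub with ⟨u, hu, hu'⟩ | ⟨v, hv, hv'⟩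
        · obtain ⟨i, rfl⟩ := (mem_left_iff (l H') u).1 hu
          exact Or.inl ⟨_, hu', sigmaPt_mem_support_left _ t i⟩
        · obtain ⟨i, rfl⟩ := (mem_right_iff (l H') v).1 hv
          refine Or.inr ⟨_, hv', ?_⟩
          rw [sigmaPt_mem_support, squareHom_p, squareFamily_right]
          refine matrixAction_ne_zero fun h => ?_
          -- The upper left entry of p_v is 1 - t or t, nonzero for interior t.
          have h00 := congrFun (congrFun h 0) 0
          have h1 : (t : ℝ) ≠ 0 := t.2.1.ne'
          have h2 : (1 - t : ℝ) ≠ 0 := (sub_pos.2 t.2.2).ne'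
          obtain rfl | rfl : i = 0 ∨ i = 1 := by omega
          · exact h2 (Complex.ofReal_eq_zero.1 h00)
          · exact h1 (Complex.ofReal_eq_zero.1 h00)
    · rintro h (⟨e, he, rfl⟩ | ⟨t, rfl⟩)
      · rw [mem_edges_iff_mem] at he
        rcases h with ⟨u, hu, h⟩ | ⟨v, hv, h⟩ <;> rw [piPt_mem_support_p] at h
        · exact hu (h ▸ he.1)
        · exact hv (h ▸ he.2)
      · rcases h with ⟨u, hu, h⟩ | ⟨v, hv, h⟩ <;> rw [sigmaPt_mem_support, squareHom_p] at h
        · rw [squareFamily_of_notMem_left _ _ hu, map_zero] at h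
          exact h rfl
        · rw [squareFamily_of_notMem_right _ _ hv, map_zero] at h
          exact h rfl
  rw [← isOpen_compl_iff, h]
  exact (isOpen_biUnion fun u _ => isOpen_support _).union
    (isOpen_biUnion fun v _ => isOpen_support _)

/-! #### The global structure -/

theorem range_piPt_union (l : ∀ H : K22Subgraph G, H.Labelling) :
    Set.range (piPt (G := G)) ∪ ⋃ H, sigmaSet (l H) = Set.univ := by
  refine Set.eq_univ_of_forall fun x => ?_
  rcases exists_piPt_or_sigmaPt l x with ⟨e, rfl⟩ | ⟨H, t, rfl⟩
  · exact Or.inl ⟨e, rfl⟩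
  · exact Or.inr (Set.mem_iUnion.2 ⟨H, t, rfl⟩)

theorem disjoint_range_piPt (l : ∀ H : K22Subgraph G, H.Labelling) :
    Disjoint (Set.range (piPt (G := G))) (⋃ H, sigmaSet (l H)) := by
  rw [Set.disjoint_left]
  rintro _ ⟨e, rfl⟩ h
  obtain ⟨H, hH⟩ := Set.mem_iUnion.1 h
  rw [sigmaSet_eq] at hH
  exact piPt_notMem_support_squareWord _ e hH

/-- All points `σ_{H,t}`, parametrized by `H` and `t`. -/
def sigmaMap (l : ∀ H : K22Subgraph G, H.Labelling) (x : Σ _ : K22Subgraph G, Set.Ioo (0 : ℝ) 1) :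
    SpecLeTwo (CStarGraph G) := sigmaPt (l x.1) x.2

theorem isOpenEmbedding_sigmaMap (l : ∀ H : K22Subgraph G, H.Labelling) :
    IsOpenEmbedding (sigmaMap l) := by
  refine .of_continuous_injective_isOpenMap ?_ ?_ ?_
  · exact continuous_sigma fun H => (isOpenEmbedding_sigmaPt l H).continuous
  · rintro ⟨H, s⟩ ⟨H', t⟩ h
    change sigmaPt (l H) s = sigmaPt (l H') t at h
    have hs := sigmaPt_mem_support_squareWord (l H) s
    rw [h] at hs
    obtain rfl := eq_of_sigmaPt_mem_support_squareWord _ _ hs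
    rw [(isOpenEmbedding_sigmaPt l H).injective h]
  · exact isOpenMap_sigma.2 fun H => (isOpenEmbedding_sigmaPt l H).isOpenMap

theorem range_sigmaMap (l : ∀ H : K22Subgraph G, H.Labelling) :
    Set.range (sigmaMap l) = ⋃ H, sigmaSet (l H) := by
  ext x
  rw [Set.mem_iUnion]
  constructor
  · rintro ⟨⟨H, t⟩, rfl⟩
    exact ⟨H, t, rfl⟩
  · rintro ⟨H, t, rfl⟩
    exact ⟨⟨H, t⟩, rfl⟩

theorem exists_homeomorph_sigma (l : ∀ H : K22Subgraph G, H.Labelling) :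
    ∃ Φ : (⋃ H, sigmaSet (l H) : Set (SpecLeTwo (CStarGraph G))) ≃ₜ
        (Σ _ : K22Subgraph G, Set.Ioo (0 : ℝ) 1),
      ∀ H, Φ '' {x | x.1 ∈ sigmaSet (l H)} = Set.range (Sigma.mk H) := by
  let Ψ := (isOpenEmbedding_sigmaMap l).isEmbedding.toHomeomorph.trans
    (Homeomorph.setCongr (range_sigmaMap l))
  refine ⟨Ψ.symm, fun H => ?_⟩
  ext y
  constructor
  · rintro ⟨x, ⟨t, ht⟩, rfl⟩
    obtain ⟨y, rfl⟩ := Ψ.surjective x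
    rw [Ψ.symm_apply_apply]
    exact ⟨t, (isOpenEmbedding_sigmaMap l).injective ht⟩
  · rintro ⟨t, rfl⟩
    exact ⟨Ψ ⟨H, t⟩, ⟨t, rfl⟩, Ψ.symm_apply_apply _⟩

/-! ### Isolated points and separation of edges -/

theorem isClopen_singleton_piPt {e : G.edges} (he : ∀ H : K22Subgraph G, e.1 ∉ H.1.edges) :
    IsClopen {piPt e} := by
  classical
  have l : ∀ H : K22Subgraph G, H.Labelling := fun H => H.2.some
  constructor
  -- Closedness: every other point has a nonzero generator at some vertex that is not an end point
  -- of e.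
  · have h : ({piPt e} : Set (SpecLeTwo (CStarGraph G)))ᶜ =
        ⋃ x ∈ {x | ¬ IsEndpoint e.1 x}, support (p G x) := by
      ext y
      simp only [Set.mem_compl_iff, Set.mem_singleton_iff, Set.mem_iUnion, exists_prop]
      constructor
      · intro hy
        rcases exists_piPt_or_sigmaPt l y with ⟨f, rfl⟩ | ⟨H, t, rfl⟩
        · have hne : ¬ (f.1.1 = e.1.1 ∧ f.1.2 = e.1.2) := fun h =>
            hy (congrArg piPt (Subtype.ext (Prod.ext h.1 h.2)))
          rw [not_and_or] at hne
          rcases hne with h | h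
          · exact ⟨Sum.inl f.1.1, h, piPt_mem_support_p.2 rfl⟩
          · exact ⟨Sum.inr f.1.2, h, piPt_mem_support_p.2 rfl⟩
        · obtain ⟨i, hi⟩ : ∃ i, ((l H).left i : U) ≠ e.1.1 := by
            by_contra! h
            exact zero_ne_one ((left_inj (l H)).1 ((h 0).trans (h 1).symm))
          exact ⟨_, hi, sigmaPt_mem_support_left _ t i⟩
      · rintro ⟨x, hx, h⟩ rfl
        exact hx (piPt_mem_support_p.1 h)
    rw [← isOpen_compl_iff, h]
    exact isOpen_biUnion fun x _ => isOpen_support _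
  -- Openness: the corner of e is nonzero only at π_e and possibly at σ_{H,t} for squares H
  -- containing e, of which there are none.
  · have h : ({piPt e} : Set (SpecLeTwo (CStarGraph G))) = cornerGt e.1 0 := by
      ext y
      rw [Set.mem_singleton_iff]
      constructor
      · rintro rfl
        rw [piPt_mem_cornerGt le_rfl, if_pos rfl]
        exact zero_lt_one
      · intro hy
        rcases exists_piPt_or_sigmaPt l y with ⟨f, rfl⟩ | ⟨H, t, rfl⟩
        · rw [piPt_mem_cornerGt le_rfl] at hy
          split_ifs at hy with hef
          · rw [Subtype.ext hef]
          · exact absurd hy (lt_irrefl _)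
        · exact absurd (mem_edges_of_sigmaPt_mem_cornerGt _ le_rfl hy) (he H)
    rw [h]
    exact isOpen_cornerGt _ _

/-- No character is nonzero on the corners of two different edges. At σ_{H,t}, changing exactly one
end point of an edge of H exchanges the corner norms t and 1 - t, so they cannot both exceed 1/2. -/
theorem disjoint_cornerGt {e f : U × V} (h : EdgeAdjacent e f) :
    Disjoint (cornerGt (G := G) e (1 / 2)) (cornerGt f (1 / 2)) := by
  classical
  have h2 : (0 : ℝ) ≤ 1 / 2 := by norm_num
  rw [Set.disjoint_left]
  intro x he hf
  rcases exists_piPt_or_sigmaPt (fun H => H.2.some) x with ⟨g, rfl⟩ | ⟨H, t, rfl⟩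
  · rw [piPt_mem_cornerGt h2] at he hf
    split_ifs at he with he'
    · split_ifs at hf with hf'
      · exact h.1 (he'.trans hf'.symm)
      · linarith
    · linarith
  · obtain ⟨i, j, rfl⟩ :=
      (mem_edges_iff H.2.some e).1 (mem_edges_of_sigmaPt_mem_cornerGt _ h2 he)
    obtain ⟨i', j', rfl⟩ :=
      (mem_edges_iff H.2.some f).1 (mem_edges_of_sigmaPt_mem_cornerGt _ h2 hf)
    rw [sigmaPt_mem_cornerGt _ h2] at he hf
    obtain ⟨hne, h⟩ := h
    rw [left_inj, right_inj] at h
    rw [Ne, Prod.ext_iff, left_inj, right_inj] at hne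
    split_ifs at he with hij <;> split_ifs at hf with hij'
    -- Equal diagonal type together with a common index would force the two edges to coincide;
    -- likewise in the last case, as indices take only two values.
    · omega
    · linarith
    · linarith
    · omega

/-- Both paths pass through the same σ_{H,s} for interior s, and (0,1) is dense in [0,1], so near t
they enter both open sets at a common point. -/
theorem not_disjoint_of_path_mem {H : K22Subgraph G} (l : H.Labelling) {i j : Fin 2}
    {t : Set.Icc (0 : ℝ) 1} {O O' : Set (SpecLeTwo (CStarGraph G))} (hO : IsOpen O)
    (hO' : IsOpen O') (h : path l i t ∈ O) (h' : path l j t ∈ O') : ¬ Disjoint O O' := by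
  obtain ⟨T, hT, hTO⟩ := isOpen_induced_iff.1
    ((hO.preimage (continuous_path l i)).inter (hO'.preimage (continuous_path l j)))
  have ht : (t : ℝ) ∈ closure (Set.Ioo (0 : ℝ) 1) := by
    rw [closure_Ioo zero_ne_one]
    exact t.2
  have htT : t ∈ Subtype.val ⁻¹' T := by
    rw [hTO]
    exact ⟨h, h'⟩
  obtain ⟨s, hsT, hs⟩ := mem_closure_iff.1 ht T hT htT
  have hsO : (⟨s, Set.Ioo_subset_Icc_self hs⟩ : Set.Icc (0 : ℝ) 1) ∈ Subtype.val ⁻¹' T := hsT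
  rw [hTO] at hsO
  have h1 : sigmaPt l ⟨s, hs⟩ ∈ O := by
    rw [sigmaPt_eq_path l i]
    exact hsO.1
  have h2 : sigmaPt l ⟨s, hs⟩ ∈ O' := by
    rw [sigmaPt_eq_path l j]
    exact hsO.2
  exact Set.not_disjoint_iff.2 ⟨_, h1, h2⟩

/-- Nonadjacent distinct edges of H differ in both indices. Such a pair is the pair of ends of the
two paths at t = 0 when the indices of each edge agree, and at t = 1 otherwise. -/
theorem exists_path_eq_of_not_edgeAdjacent {H : K22Subgraph G} (l : H.Labelling) {e f : G.edges}
    (hef : e ≠ f) (he : e.1 ∈ H.1.edges) (hf : f.1 ∈ H.1.edges) (h : ¬ EdgeAdjacent e.1 f.1) :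
    ∃ i j t, path l i t = piPt e ∧ path l j t = piPt f := by
  obtain ⟨e, he'⟩ := e
  obtain ⟨f, hf'⟩ := f
  obtain ⟨i, j, rfl⟩ := (mem_edges_iff l e).1 he
  obtain ⟨i', j', rfl⟩ := (mem_edges_iff l f).1 hf
  have h := fun h' => h ⟨fun h => hef (Subtype.ext h), h'⟩
  simp only [left_inj, right_inj] at h
  have hi : i ≠ i' := fun h' => h (Or.inl h')
  have hj : j ≠ j' := fun h' => h (Or.inr h')
  obtain rfl : i' = i + 1 := by omega
  obtain rfl : j' = j + 1 := by omega
  obtain rfl | rfl : j = i ∨ j = i + 1 := by omega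
  · exact ⟨j, j + 1, ⟨0, by simp⟩, path_zero l _ rfl, path_zero l _ rfl⟩
  · exact ⟨i, i + 1, ⟨1, by simp⟩, path_one l _ rfl, path_one l _ rfl⟩

end SpecLeTwo

end

theorem mainTheorem4 {U : Type u} {V : Type v} [Fintype U] [Fintype V] (G : BipartiteGraph U V)
    (l : ∀ H : K22Subgraph G, H.Labelling) :
    -- the points of the space
    ((Set.range (piPt (G := G)) ∪ ⋃ H, sigmaSet (l H) = Set.univ) ∧
      Disjoint (Set.range (piPt (G := G))) (⋃ H, sigmaSet (l H))) ∧
    -- `X_H` is closed and homeomorphic to `X`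
    (∀ H : K22Subgraph G, IsClosed (XSet (l H)) ∧ Nonempty (XSet (l H) ≃ₜ SpaceX)) ∧
    -- the two-dimensional part is a disjoint union of open intervals
    (∃ Φ : (⋃ H, sigmaSet (l H) : Set (SpecLeTwo (CStarGraph G))) ≃ₜ
        (Σ _ : K22Subgraph G, Set.Ioo (0 : ℝ) 1),
      ∀ H, Φ '' {x | x.1 ∈ sigmaSet (l H)} = Set.range (Sigma.mk H)) ∧
    -- edges outside every `K_{2,2}`
    (∀ e : G.edges, (∀ H : K22Subgraph G, e.1 ∉ H.1.edges) → IsClopen {piPt e}) ∧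
    -- distinct edges in a common `K_{2,2}`
    (∀ (H : K22Subgraph G) (e₁ e₂ : G.edges), e₁ ≠ e₂ → e₁.1 ∈ H.1.edges → e₂.1 ∈ H.1.edges →
      ((∃ O₁ O₂ : Set (SpecLeTwo (CStarGraph G)), IsOpen O₁ ∧ IsOpen O₂ ∧
          piPt e₁ ∈ O₁ ∧ piPt e₂ ∈ O₂ ∧ Disjoint O₁ O₂) ↔ EdgeAdjacent e₁.1 e₂.1)) ∧
    -- neighbourhoods of the two-dimensional points
    (∀ (H : K22Subgraph G) (t : Set.Ioo (0 : ℝ) 1), ∃ O : Set (SpecLeTwo (CStarGraph G)),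
      IsOpen O ∧ sigmaPt (l H) t ∈ O ∧ Nonempty (O ≃ₜ Set.Ioo (0 : ℝ) 1)) := by
  refine ⟨⟨SpecLeTwo.range_piPt_union l, SpecLeTwo.disjoint_range_piPt l⟩, fun H =>
    ⟨SpecLeTwo.isClosed_XSet l H, ⟨SpecLeTwo.homeomorphSpaceX (l H)⟩⟩,
    SpecLeTwo.exists_homeomorph_sigma l, fun e he => SpecLeTwo.isClopen_singleton_piPt he,
    fun H e₁ e₂ hne h₁ h₂ => ⟨?_, fun h => ?_⟩, fun H t => ?_⟩
  · rintro ⟨O₁, O₂, hO₁, hO₂, he₁, he₂, hd⟩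
    by_contra h
    obtain ⟨i, j, t, he, hf⟩ :=
      SpecLeTwo.exists_path_eq_of_not_edgeAdjacent (l H) hne h₁ h₂ h
    exact SpecLeTwo.not_disjoint_of_path_mem (l H) hO₁ hO₂ (he ▸ he₁) (hf ▸ he₂) hd
  · classical
    refine ⟨_, _, SpecLeTwo.isOpen_cornerGt e₁.1 (1 / 2), SpecLeTwo.isOpen_cornerGt e₂.1 (1 / 2),
      ?_, ?_, SpecLeTwo.disjoint_cornerGt h⟩ <;>
    · rw [SpecLeTwo.piPt_mem_cornerGt (by norm_num), if_pos rfl]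
      norm_num
  · exact ⟨sigmaSet (l H), SpecLeTwo.isOpen_sigmaSet l H, ⟨t, rfl⟩,
      ⟨(SpecLeTwo.isOpenEmbedding_sigmaPt l H).isEmbedding.toHomeomorph.symm⟩⟩
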